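/- Let $\mathbb{T}=\mathbb{R}/2\pi\mathbb{Z}$ and let $A(\mathbb{T})$ be the space of continuous complex functions on $\mathbb{T}$ with absolutely convergent Fourier series. A compact set $K\subset\mathbb{T}$ is called a Helson set if every continuous complex function on $K$ extends to a function in $A(\mathbb{T})$. For every real number $q>2$ there exist a Helson set $K\subset\mathbb{T}$ and a non-zero Schwartz distribution $S$ on $\mathbb{T}$ whose closed support is contained in $K$ and whose Fourier coefficients $\widehat{S}(n)=\langle S,e^{-int}\rangle$, $n\in\mathbb{Z}$, satisfy $\sum_{n\in\mathbb{Z}}|\widehat{S}(n)|^q<\infty$. -/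

import Mathlib

open scoped ContDiff

noncomputable section

namespace HelsonCircle

/-- The circle `ℝ / 2πℤ`. -/
abbrev Torus : Type := AddCircle (2 * Real.pi)

instance two_pi_pos_fact : Fact (0 < 2 * Real.pi) := ⟨Real.two_pi_pos⟩

/-- The `2π`-periodic function on `ℝ` attached to a function on the circle. -/
def periodize (f : Torus → ℂ) : ℝ → ℂ := fun x => f (x : Torus)

/-- The Wiener algebra: continuous functions on the circle with an absolutely convergent
Fourier series. -/
def MemWiener (f : C(Torus, ℂ)) : Prop :=
  Summable fun n : ℤ => ‖fourierCoeff (f : Torus → ℂ) n‖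

/-- A compact set is a Helson set if every continuous function on it extends to a function
in the Wiener algebra. -/
def IsHelson (K : Set Torus) : Prop :=
  IsCompact K ∧ ∀ g : C(K, ℂ), ∃ f : C(Torus, ℂ), MemWiener f ∧ ∀ x : K, f x = g x

/-- The space of smooth complex test functions on the circle. -/
def Test : Submodule ℂ C(Torus, ℂ) where
  carrier := {f | ContDiff ℝ ∞ (periodize f)}
  add_mem' := fun {f g} (hf : ContDiff ℝ ∞ (periodize f)) (hg : ContDiff ℝ ∞ (periodize g)) =>
    ContDiff.add hf hg
  zero_mem' := (contDiff_const : ContDiff ℝ ∞ fun _ : ℝ => (0 : ℂ))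
  smul_mem' := fun c f (hf : ContDiff ℝ ∞ (periodize f)) => ContDiff.const_smul c hf

theorem fourier_mem_test (n : ℤ) : (fourier n : C(Torus, ℂ)) ∈ Test := by
  change ContDiff ℝ ∞ (fun x : ℝ => (fourier n : C(Torus, ℂ)) (x : Torus))
  simp only [fourier_coe_apply]
  have h : ContDiff ℝ ∞ (fun x : ℝ => (x : ℂ)) := Complex.ofRealCLM.contDiff
  fun_prop

/-- The exponential `t ↦ exp (i n t)` as a test function. -/
def expTest (n : ℤ) : Test := ⟨fourier n, fourier_mem_test n⟩

/-- Schwartz distributions on the circle: linear functionals on the smooth functions that are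
continuous, i.e. bounded by a multiple of some `C^N` norm. -/
structure Distr where
  toFun : Test →ₗ[ℂ] ℂ
  bounded' : ∃ (N : ℕ) (C : ℝ), ∀ (φ : Test) (M : ℝ),
    (∀ j ≤ N, ∀ x : ℝ, ‖iteratedDeriv j (periodize (φ : C(Torus, ℂ))) x‖ ≤ M) →
      ‖toFun φ‖ ≤ C * M

namespace Distr

/-- The Fourier coefficients `⟨S, exp (-i n t)⟩` of a distribution. -/
def coeff (S : Distr) (n : ℤ) : ℂ := S.toFun (expTest (-n))

/-- `S` vanishes on the set `U` (used for open sets): it kills all test functions whose closed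
support is contained in `U`. -/
def VanishesOn (S : Distr) (U : Set Torus) : Prop :=
  ∀ φ : Test, tsupport (φ : C(Torus, ℂ)) ⊆ U → S.toFun φ = 0

/-- The closed support: the complement of the union of all open sets on which `S` vanishes. -/
def support (S : Distr) : Set Torus :=
  (⋃₀ {U : Set Torus | IsOpen U ∧ S.VanishesOn U})ᶜ

end Distr

end HelsonCircle

end

open scoped ContDiff ENNReal
open MeasureTheory AddCircle

namespace HelsonCircle

/-! The distribution is an infinite product of smooth multipliers `F k`, each close to 1 in `ℓ^q` of
its Fourier coefficients. Each `F k` vanishes off the set where a prescribed smooth unimodular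
function `v` correlates with an average `h` of exponentials: Re(v h) ≥ c, with c > 0 depending on q
only. Letting v run through a dense sequence, K is the closed set where all these correlations hold.
The partial products converge in `ℓ^q`, the zeroth coefficient of the limit stays away from 0, and
the limit is supported in K.

K is Helson: a real u on K with |u| ≤ 1 is the real part of some unimodular v up to a small error,
and the correlation forces |Re v - c Re h| ≤ 1 - c²/2 (`abs_re_sub_le_of_correlation`). So u is
approximated, with a loss factor below 1, by the real part of a function in the unit ball of the
Wiener algebra; iterating gives every continuous function (`surjective_of_approx`,
`isHelson_of_correlation`).

The multiplier (`exists_multiplier`) comes from Riesz-type products ∏ⱼ (1 + s Re zⱼ + (s²/4) Re zⱼ²)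
with zⱼ = v exp(i M 5^j t), which behave like exp(s ∑ Re zⱼ - s²N/4) and so are tiny where ∑ Re zⱼ
is small. Averaging in s ∈ [η/2, η] against a signed measure of mass one with n vanishing moments
removes every nonconstant term of degree at most n. The remainder is small in `ℓ^q` when η^q N is
comparable to a small multiple of n, while smallness off the correlation set needs η² N to be a
large multiple of n. Both are possible precisely because q > 2. A smooth cutoff then costs only a
small uniform error, which dominates the `ℓ^q` error. -/

/-! ### Fourier coefficients of continuous functions in `ℓ^p`, p ≥ 2 -/

theorem norm_fourierCoeff_le (f : C(Torus, ℂ)) (n : ℤ) :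
    ‖fourierCoeff (f : Torus → ℂ) n‖ ≤ ‖f‖ := by
  rw [fourierCoeff]
  refine (norm_integral_le_of_norm_le_const (C := ‖f‖) ?_).trans ?_
  · refine Filter.Eventually.of_forall fun t => ?_
    rw [norm_smul, fourier_apply, Circle.norm_coe, one_mul]
    exact f.norm_coe_le_norm t
  · simp

theorem integrable_coe (f : C(Torus, ℂ)) : Integrable (f : Torus → ℂ) haarAddCircle :=
  f.continuous.integrable_of_hasCompactSupport (HasCompactSupport.of_compactSpace _)

theorem fourierCoeff_coe_add (f g : C(Torus, ℂ)) (n : ℤ) :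
    fourierCoeff ((f + g : C(Torus, ℂ)) : Torus → ℂ) n
      = fourierCoeff (f : Torus → ℂ) n + fourierCoeff (g : Torus → ℂ) n := by
  rw [ContinuousMap.coe_add, fourierCoeff.add (integrable_coe f) (integrable_coe g)]
  rfl

/-- A Fourier coefficient as a continuous linear functional on `C(𝕋)`. -/
noncomputable def coeffCLM (n : ℤ) : C(Torus, ℂ) →L[ℂ] ℂ :=
  LinearMap.mkContinuous
    { toFun := fun f => fourierCoeff (f : Torus → ℂ) n
      map_add' := fun f g => fourierCoeff_coe_add f g n
      map_smul' := fun c f => fourierCoeff.const_smul (f : Torus → ℂ) c n } 1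
    fun f => by simpa using norm_fourierCoeff_le f n

@[simp] theorem coeffCLM_apply (n : ℤ) (f : C(Torus, ℂ)) :
    coeffCLM n f = fourierCoeff (f : Torus → ℂ) n := rfl

theorem hasSum_sq_fourierCoeff_coe (f : C(Torus, ℂ)) :
    HasSum (fun n => ‖fourierCoeff (f : Torus → ℂ) n‖ ^ 2)
      (∫ t : Torus, ‖f t‖ ^ 2 ∂haarAddCircle) := by
  have h := hasSum_sq_fourierCoeff (ContinuousMap.toLp (E := ℂ) 2 haarAddCircle ℂ f)
  simp_rw [fourierCoeff_toLp] at h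
  convert! h using 1
  refine integral_congr_ae ?_
  filter_upwards [ContinuousMap.coeFn_toLp (p := 2) (𝕜 := ℂ) haarAddCircle f] with t ht
  rw [ht]

theorem sum_sq_fourierCoeff_le (f : C(Torus, ℂ)) (s : Finset ℤ) :
    ∑ n ∈ s, ‖fourierCoeff (f : Torus → ℂ) n‖ ^ 2 ≤ ‖f‖ ^ 2 := by
  refine (sum_le_hasSum s (fun n _ => by positivity) (hasSum_sq_fourierCoeff_coe f)).trans ?_
  have h : ∫ t : Torus, ‖f t‖ ^ 2 ∂haarAddCircle ≤ ∫ _t : Torus, ‖f‖ ^ 2 ∂haarAddCircle := by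
    refine integral_mono ?_ (integrable_const _) fun t => ?_
    · exact (f.continuous.norm.pow 2).integrable_of_hasCompactSupport
        (HasCompactSupport.of_compactSpace _)
    · exact pow_le_pow_left₀ (norm_nonneg _) (f.norm_coe_le_norm t) 2
  simpa using h

/-- Bessel's inequality, after bounding q - 2 of the powers of each coefficient by the uniform norm.
This is how uniform errors become `ℓ^q` errors. -/
theorem sum_rpow_fourierCoeff_le {q : ℝ} (hq : 2 ≤ q) (f : C(Torus, ℂ)) (s : Finset ℤ) :
    ∑ n ∈ s, ‖fourierCoeff (f : Torus → ℂ) n‖ ^ q ≤ ‖f‖ ^ q := by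
  have key : ∀ x y : ℝ, 0 ≤ x → x ≤ y → x ^ q ≤ y ^ (q - 2) * x ^ 2 := by
    intro x y hx hxy
    rcases hx.eq_or_lt with rfl | hx0
    · rw [Real.zero_rpow (by linarith)]; positivity
    · have : x ^ q = x ^ (q - 2) * x ^ 2 := by
        rw [← Real.rpow_natCast x 2, ← Real.rpow_add hx0]; norm_num
      rw [this]
      gcongr
  calc ∑ n ∈ s, ‖fourierCoeff (f : Torus → ℂ) n‖ ^ q
      ≤ ∑ n ∈ s, ‖f‖ ^ (q - 2) * ‖fourierCoeff (f : Torus → ℂ) n‖ ^ 2 :=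
        Finset.sum_le_sum fun n _ => key _ _ (norm_nonneg _) (norm_fourierCoeff_le f n)
    _ ≤ ‖f‖ ^ (q - 2) * ‖f‖ ^ 2 := by
        rw [← Finset.mul_sum]
        gcongr
        exact sum_sq_fourierCoeff_le f s
    _ = ‖f‖ ^ q := by
        rcases (norm_nonneg f).eq_or_lt with h | h
        · rw [← h, Real.zero_rpow (by linarith : q ≠ 0)]; simp
        · rw [← Real.rpow_natCast _ 2, ← Real.rpow_add h]; norm_num

/-- The space `ℓ^p(ℤ)`. -/
abbrev SeqLp (p : ℝ≥0∞) : Type := lp (fun _ : ℤ => ℂ) p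

theorem two_le_toReal (p : ℝ≥0∞) [hp : Fact (2 ≤ p)] [hpt : Fact (p ≠ ⊤)] : 2 ≤ p.toReal := by
  have := ENNReal.toReal_mono hpt.out hp.out
  simpa using this

theorem memℓp_fourierCoeff (p : ℝ≥0∞) [hp : Fact (2 ≤ p)] [hpt : Fact (p ≠ ⊤)] (f : C(Torus, ℂ)) :
    Memℓp (fun n => fourierCoeff (f : Torus → ℂ) n) p :=
  memℓp_gen' (C := ‖f‖ ^ p.toReal) fun s => sum_rpow_fourierCoeff_le (two_le_toReal p) f s

/-- The sequence of Fourier coefficients of a continuous function, in `ℓ^p` with `2 ≤ p < ∞`. -/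
noncomputable def coeffLp (p : ℝ≥0∞) [Fact (1 ≤ p)] [hp : Fact (2 ≤ p)] [hpt : Fact (p ≠ ⊤)] :
    C(Torus, ℂ) →L[ℂ] SeqLp p :=
  LinearMap.mkContinuous
    { toFun := fun f => ⟨fun n => fourierCoeff (f : Torus → ℂ) n, memℓp_fourierCoeff p f⟩
      map_add' := fun f g => by
        ext n; exact fourierCoeff_coe_add f g n
      map_smul' := fun c f => by
        ext n; exact fourierCoeff.const_smul (f : Torus → ℂ) c n } 1
    fun f => by
      rw [one_mul]
      have h2 := two_le_toReal p
      refine lp.norm_le_of_forall_sum_le (by linarith) (norm_nonneg f) fun s => ?_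
      exact sum_rpow_fourierCoeff_le h2 f s

@[simp] theorem coeffLp_apply (p : ℝ≥0∞) [Fact (1 ≤ p)] [hp : Fact (2 ≤ p)] [hpt : Fact (p ≠ ⊤)]
    (f : C(Torus, ℂ)) (n : ℤ) :
    coeffLp p f n = fourierCoeff (f : Torus → ℂ) n := rfl

theorem norm_coeffLp_le (p : ℝ≥0∞) [Fact (1 ≤ p)] [hp : Fact (2 ≤ p)] [hpt : Fact (p ≠ ⊤)]
    (f : C(Torus, ℂ)) : ‖coeffLp p f‖ ≤ ‖f‖ := by
  have h := (coeffLp p).le_of_opNorm_le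
    (LinearMap.mkContinuous_norm_le _ zero_le_one _ : ‖coeffLp p‖ ≤ 1) f
  simpa using h

theorem fourierCoeff_fourier_mul (k : ℤ) (f : C(Torus, ℂ)) (n : ℤ) :
    fourierCoeff ((fourier k * f : C(Torus, ℂ)) : Torus → ℂ) n
      = fourierCoeff (f : Torus → ℂ) (n - k) := by
  simp only [fourierCoeff]
  refine integral_congr_ae (Filter.Eventually.of_forall fun t => ?_)
  simp only [ContinuousMap.coe_mul, Pi.mul_apply, smul_eq_mul]
  rw [← mul_assoc, ← fourier_add]
  congr 2
  rw [neg_add_eq_sub, neg_sub]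

theorem norm_coeffLp_fourier_mul (p : ℝ≥0∞) [Fact (1 ≤ p)] [hp : Fact (2 ≤ p)] [hpt : Fact (p ≠ ⊤)]
    (k : ℤ) (f : C(Torus, ℂ)) :
    ‖coeffLp p (fourier k * f)‖ = ‖coeffLp p f‖ := by
  have h2 := two_le_toReal p
  have h0 : 0 < p.toReal := by linarith
  rw [lp.norm_eq_tsum_rpow h0, lp.norm_eq_tsum_rpow h0]
  congr 1
  simp only [coeffLp_apply, fourierCoeff_fourier_mul]
  exact (Equiv.subRight k).tsum_eq
    fun n => ‖fourierCoeff (f : Torus → ℂ) n‖ ^ p.toReal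

/-- Multiplication by an exponential shifts the coefficients isometrically, so expanding `P` costs
its Wiener norm. In the infinite product, `w` is F - 1 and `P` is the product already built. -/
theorem norm_coeffLp_mul_le (p : ℝ≥0∞) [Fact (1 ≤ p)] [hp : Fact (2 ≤ p)] [hpt : Fact (p ≠ ⊤)]
    {P : C(Torus, ℂ)} (hP : MemWiener P) (w : C(Torus, ℂ)) :
    ‖coeffLp p (P * w)‖ ≤ (∑' n, ‖fourierCoeff (P : Torus → ℂ) n‖) * ‖coeffLp p w‖ := by
  have h1 : HasSum (fun n => fourierCoeff (P : Torus → ℂ) n • (fourier n : C(Torus, ℂ))) P :=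
    hasSum_fourier_series_of_summable hP.of_norm
  have h2 : HasSum (fun n => coeffLp p
      ((fourierCoeff (P : Torus → ℂ) n • (fourier n : C(Torus, ℂ))) * w)) (coeffLp p (P * w)) :=
    (coeffLp p).hasSum (h1.mul_right w)
  rw [← h2.tsum_eq]
  refine tsum_of_norm_bounded ((hP.hasSum).mul_right _) fun n => ?_
  rw [smul_mul_assoc, map_smul, norm_smul, norm_coeffLp_fourier_mul]

/-! ### Smooth test functions and the decay of their coefficients -/

theorem contDiff_periodize {φ : C(Torus, ℂ)} (h : φ ∈ Test) : ContDiff ℝ ∞ (periodize φ) := h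

theorem mem_test_of_contDiff {φ : C(Torus, ℂ)} (h : ContDiff ℝ ∞ (periodize φ)) : φ ∈ Test := h

theorem mul_mem_test {φ ψ : C(Torus, ℂ)} (hφ : φ ∈ Test) (hψ : ψ ∈ Test) : φ * ψ ∈ Test :=
  ContDiff.mul (contDiff_periodize hφ) (contDiff_periodize hψ)

theorem star_mem_test {φ : C(Torus, ℂ)} (hφ : φ ∈ Test) : star φ ∈ Test :=
  Complex.conjCLE.contDiff.comp (contDiff_periodize hφ)

theorem one_mem_test : (1 : C(Torus, ℂ)) ∈ Test :=
  (contDiff_const : ContDiff ℝ ∞ fun _ : ℝ => (1 : ℂ))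

theorem prod_mem_test {ι : Type*} (s : Finset ι) {u : ι → C(Torus, ℂ)}
    (h : ∀ i ∈ s, u i ∈ Test) : ∏ i ∈ s, u i ∈ Test := by
  classical
  induction s using Finset.induction_on with
  | empty => simpa using one_mem_test
  | insert a s ha ih =>
    rw [Finset.prod_insert ha]
    exact mul_mem_test (h a (by simp)) (ih fun i hi => h i (by simp [hi]))

theorem periodize_periodic (f : Torus → ℂ) : Function.Periodic (periodize f) (2 * Real.pi) := by
  intro x
  simp only [periodize]
  rw [AddCircle.coe_add_period]

theorem fourierCoeff_eq_fourierCoeffOn (f : Torus → ℂ) (n : ℤ) :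
    fourierCoeff f n = fourierCoeffOn Real.two_pi_pos (periodize f) n := by
  rw [fourierCoeff_eq_intervalIntegral f n 0, fourierCoeffOn_eq_integral]
  simp only [fourier_coe_apply, periodize, sub_zero, zero_add]

theorem norm_fourierCoeffOn_le {f : ℝ → ℂ} {M : ℝ} (h : ∀ x, ‖f x‖ ≤ M) (n : ℤ) :
    ‖fourierCoeffOn Real.two_pi_pos f n‖ ≤ M := by
  rw [fourierCoeffOn_eq_integral, norm_smul]
  have h1 := intervalIntegral.norm_integral_le_of_norm_le_const (a := 0) (b := 2 * Real.pi)
    (f := fun x : ℝ => fourier (-n) (x : AddCircle (2 * Real.pi - 0)) • f x) (C := M)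
    (fun x _ => by
      rw [norm_smul, fourier_apply, Circle.norm_coe, one_mul]; exact h x)
  have hpi := Real.pi_pos
  rw [sub_zero, abs_of_pos Real.two_pi_pos] at h1
  rw [sub_zero, Real.norm_of_nonneg (by positivity)]
  calc _ ≤ 1 / (2 * Real.pi) * (M * (2 * Real.pi)) := by gcongr
    _ = M := by field_simp

theorem fourierCoeffOn_deriv {f : ℝ → ℂ} (hf : ContDiff ℝ 1 f)
    (hp : Function.Periodic f (2 * Real.pi)) {n : ℤ} (hn : n ≠ 0) :
    ‖fourierCoeffOn Real.two_pi_pos f n‖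
      = ‖fourierCoeffOn Real.two_pi_pos (deriv f) n‖ / |(n : ℝ)| := by
  have hpi := Real.pi_pos
  rw [fourierCoeffOn_of_hasDerivAt Real.two_pi_pos hn
    (fun x _ => (hf.differentiable one_ne_zero x).hasDerivAt)
    ((hf.continuous_deriv le_rfl).intervalIntegrable _ _)]
  have h0 : f (2 * Real.pi) = f 0 := by simpa using hp 0
  rw [h0, sub_self, mul_zero, zero_sub]
  have hn' : |(n : ℝ)| ≠ 0 := by simpa using hn
  simp [abs_of_pos hpi]
  field_simp

/-- A summable weight on `ℤ` that dominates the Fourier coefficients of `C²` functions. -/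
noncomputable def decayWeight (n : ℤ) : ℝ := 1 / (n : ℝ) ^ 2 + Pi.single (M := fun _ => ℝ) 0 1 n

theorem summable_decayWeight : Summable decayWeight :=
  (Real.summable_one_div_int_pow.mpr one_lt_two).add (hasSum_pi_single 0 1).summable

/-- Two integrations by parts for n ≠ 0. At n = 0 the quotient in the weight is 0 by convention, and
its point mass takes over. -/
theorem norm_fourierCoeff_le_decayWeight {φ : C(Torus, ℂ)} (hφ : φ ∈ Test) {M : ℝ}
    (h0 : ∀ x, ‖periodize φ x‖ ≤ M) (h2 : ∀ x, ‖iteratedDeriv 2 (periodize φ) x‖ ≤ M) (n : ℤ) :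
    ‖fourierCoeff (φ : Torus → ℂ) n‖ ≤ M * decayWeight n := by
  rw [fourierCoeff_eq_fourierCoeffOn]
  rcases eq_or_ne n 0 with rfl | hn
  · simpa [decayWeight] using norm_fourierCoeffOn_le h0 0
  · have hs := contDiff_periodize hφ
    have hp : Function.Periodic (periodize φ) (2 * Real.pi) := periodize_periodic φ
    have hp' : Function.Periodic (deriv (periodize φ)) (2 * Real.pi) := by
      intro x
      rw [← deriv_comp_add_const]
      congr 1
      exact funext hp
    have hs' : ContDiff ℝ 1 (deriv (periodize φ)) := by
      have : ContDiff ℝ 2 (periodize φ) := contDiff_infty.mp hs 2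
      exact ((contDiff_succ_iff_deriv (n := 1)).mp (by exact_mod_cast this)).2.2
    rw [fourierCoeffOn_deriv (hs.of_le (by exact_mod_cast le_top)) hp hn,
      fourierCoeffOn_deriv hs' hp' hn]
    have h3 := norm_fourierCoeffOn_le
      (f := deriv (deriv (periodize φ))) (M := M) (fun x => by
        have := h2 x
        rwa [iteratedDeriv_succ, iteratedDeriv_one] at this) n
    have hn' : 0 < |(n : ℝ)| := by simpa using hn
    rw [div_div, ← sq, sq_abs, decayWeight, Pi.single_eq_of_ne hn, add_zero, mul_one_div]
    gcongr

theorem exists_bound_iteratedDeriv {φ : C(Torus, ℂ)} (hφ : φ ∈ Test) (j : ℕ) :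
    ∃ M, ∀ x, ‖iteratedDeriv j (periodize φ) x‖ ≤ M := by
  have hs := contDiff_periodize hφ
  have hc : Continuous (iteratedDeriv j (periodize φ)) :=
    hs.continuous_iteratedDeriv j (by exact_mod_cast le_top)
  have hp : Function.Periodic (iteratedDeriv j (periodize φ)) (2 * Real.pi) := by
    intro x
    have h := congrFun (iteratedDeriv_comp_add_const j (periodize φ) (2 * Real.pi)) x
    rw [← h]
    congr 1
    exact funext (periodize_periodic φ)
  obtain ⟨M, hM⟩ := (isCompact_Icc (a := (0 : ℝ)) (b := 2 * Real.pi)).exists_bound_of_continuousOn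
    hc.continuousOn
  refine ⟨M, fun x => ?_⟩
  obtain ⟨y, hy, hxy⟩ := hp.exists_mem_Ico₀ Real.two_pi_pos x
  rw [hxy]
  exact hM y ⟨hy.1, hy.2.le⟩

theorem memWiener_of_mem_test {φ : C(Torus, ℂ)} (hφ : φ ∈ Test) : MemWiener φ := by
  obtain ⟨M, hM⟩ := exists_bound_iteratedDeriv hφ 2
  obtain ⟨M', hM'⟩ := exists_bound_iteratedDeriv hφ 0
  have h := norm_fourierCoeff_le_decayWeight hφ (M := max M M')
    (fun x => by simpa using Or.inr (hM' x)) (fun x => (hM x).trans (le_max_left _ _))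
  exact Summable.of_nonneg_of_le (fun _ => norm_nonneg _) h (summable_decayWeight.mul_left _)

/-! ### Separated blocks of frequencies -/

/-- The norm of a combination of distinct point masses in `ℓ^p`. -/
theorem norm_sum_smul_single_rpow (p : ℝ≥0∞) [Fact (1 ≤ p)] (hp : 0 < p.toReal) {ι : Type*}
    (s : Finset ι) {e : ι → ℤ} (he : Set.InjOn e s) (a : ι → ℂ) :
    ‖∑ i ∈ s, (lp.single p (e i) (a i) : SeqLp p)‖ ^ p.toReal = ∑ i ∈ s, ‖a i‖ ^ p.toReal := by
  classical
  rcases s.eq_empty_or_nonempty with rfl | ⟨i₀, hi₀⟩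
  · simp [Real.zero_rpow hp.ne']
  have : Nonempty ι := ⟨i₀⟩
  have hinv : ∀ i ∈ s, Function.invFunOn e s (e i) = i := fun i hi =>
    he.leftInvOn_invFunOn hi
  have h := lp.norm_sum_single (p := p) hp (E := fun _ : ℤ => ℂ)
    (fun k => a (Function.invFunOn e s k)) (s.image e)
  rw [Finset.sum_image he, Finset.sum_image he] at h
  rw [Finset.sum_congr rfl fun i hi => by rw [hinv i hi]] at h
  rw [h]
  exact Finset.sum_congr rfl fun i hi => by rw [hinv i hi]

/-- Fourier coefficients of `∑ c_i u_i exp (i M κ_i t)` are nearly disjoint blocks for some `M`. -/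
theorem exists_norm_coeffLp_sum_le (p : ℝ≥0∞) [Fact (1 ≤ p)] [Fact (2 ≤ p)] [hpt : Fact (p ≠ ⊤)]
    {ι : Type*} (s : Finset ι) {κ : ι → ℤ} (hκ : Set.InjOn κ s) (c : ι → ℂ)
    (u : ι → C(Torus, ℂ)) (hu : ∀ i, ‖u i‖ ≤ 1) {ε : ℝ} (hε : 0 < ε) :
    ∃ M : ℤ, 0 < M ∧ ‖coeffLp p (∑ i ∈ s, c i • (fourier (M * κ i) * u i))‖
      ≤ (∑ i ∈ s, ‖c i‖ ^ p.toReal) ^ (1 / p.toReal) + ε := by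
  classical
  have h2 := two_le_toReal p
  have h0 : 0 < p.toReal := by linarith
  set A : ℝ := ∑ i ∈ s, ‖c i‖ with hA
  have hA0 : 0 ≤ A := Finset.sum_nonneg fun i _ => norm_nonneg _
  have hδ : 0 < ε / (A + 1) := by positivity
  -- truncation of all coefficient sequences at once
  obtain ⟨W, hW⟩ : ∃ W : Finset ℤ, ∀ i ∈ s,
      ‖coeffLp p (u i) - ∑ n ∈ W, lp.single p n (coeffLp p (u i) n)‖ ≤ ε / (A + 1) := by
    have hev : ∀ i ∈ s, ∀ᶠ W : Finset ℤ in Filter.atTop,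
        ‖coeffLp p (u i) - ∑ n ∈ W, lp.single p n (coeffLp p (u i) n)‖ ≤ ε / (A + 1) := by
      intro i _
      have h := lp.hasSum_single hpt.out (coeffLp p (u i))
      have := (Metric.tendsto_nhds.mp h) _ hδ
      filter_upwards [this] with W hW
      rw [← dist_eq_norm, dist_comm]
      exact hW.le
    exact ((Finset.eventually_all s).mpr hev).exists
  obtain ⟨D, hD⟩ : ∃ D : ℤ, ∀ n ∈ W, |n| ≤ D :=
    ⟨∑ n ∈ W, |n|, fun n hn => Finset.single_le_sum (f := fun n => |n|)
      (fun i _ => abs_nonneg i) hn⟩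
  -- Points of the window [-|D|, |D|] differ by at most 2|D|, so its translates by distinct
  -- multiples of this M are disjoint.
  refine ⟨2 * |D| + 1, by positivity, ?_⟩
  set M : ℤ := 2 * |D| + 1 with hM
  set main : SeqLp p := ∑ x ∈ s ×ˢ W,
    lp.single p (x.2 + M * κ x.1) (c x.1 * coeffLp p (u x.1) x.2) with hmain
  have hinj : Set.InjOn (fun x : ι × ℤ => x.2 + M * κ x.1) (s ×ˢ W : Finset (ι × ℤ)) := by
    rintro ⟨i, n⟩ hin ⟨j, m⟩ hjm h
    simp only [Finset.coe_product, Set.mem_prod, Finset.mem_coe] at hin hjm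
    simp only at h
    have hn := (abs_le.mp ((hD n hin.2).trans (le_abs_self D)))
    have hm := (abs_le.mp ((hD m hjm.2).trans (le_abs_self D)))
    have hk : κ i = κ j := by
      by_contra hne
      rcases lt_or_gt_of_ne hne with hlt | hlt
      · have : M * (κ i + 1) ≤ M * κ j := by gcongr; omega
        rw [mul_add] at this; omega
      · have : M * (κ j + 1) ≤ M * κ i := by gcongr; omega
        rw [mul_add] at this; omega
    have hij := hκ hin.1 hjm.1 hk
    subst hij
    simp only [Prod.mk.injEq, true_and]
    omega
  have hmain_le : ‖main‖ ≤ (∑ i ∈ s, ‖c i‖ ^ p.toReal) ^ (1 / p.toReal) := by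
    have h := norm_sum_smul_single_rpow p h0 (s ×ˢ W) hinj
      (fun x => c x.1 * coeffLp p (u x.1) x.2)
    have hle : ‖main‖ ^ p.toReal ≤ ∑ i ∈ s, ‖c i‖ ^ p.toReal := by
      rw [hmain, h, Finset.sum_product]
      refine Finset.sum_le_sum fun i _ => ?_
      simp only [norm_mul, Real.mul_rpow (norm_nonneg _) (norm_nonneg _)]
      rw [← Finset.mul_sum]
      refine mul_le_of_le_one_right (by positivity) ?_
      refine (sum_rpow_fourierCoeff_le h2 (u i) W).trans ?_
      exact Real.rpow_le_one (norm_nonneg _) (hu i) h0.le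
    rw [one_div]
    exact (Real.le_rpow_inv_iff_of_pos (norm_nonneg _) (by positivity) h0).mpr hle
  have hshift : ∀ i, ∑ n ∈ W, (lp.single p (n + M * κ i) (c i * coeffLp p (u i) n) : SeqLp p)
      = coeffLp p (c i • (fourier (M * κ i) * ∑ n ∈ W, fourierCoeff (u i) n • fourier n)) := by
    intro i
    rw [map_smul, Finset.mul_sum, map_sum, Finset.smul_sum]
    refine Finset.sum_congr rfl fun n _ => ?_
    rw [mul_smul_comm, map_smul]
    have : (fourier (M * κ i) * fourier n : C(Torus, ℂ)) = fourier (n + M * κ i) := by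
      ext t; rw [ContinuousMap.mul_apply, ← fourier_add, add_comm]
    rw [this]
    ext k
    simp only [lp.single_apply, lp.coeFn_smul, Pi.smul_apply, coeffLp_apply,
      fourierCoeff_fourier, smul_eq_mul]
    by_cases hk : k = n + M * κ i
    · subst hk; simp
    · simp [Pi.single_eq_of_ne hk]
  have htr : ∀ i, coeffLp p (∑ n ∈ W, fourierCoeff (u i) n • fourier n)
      = ∑ n ∈ W, lp.single p n (coeffLp p (u i) n) := by
    intro i
    rw [map_sum]
    refine Finset.sum_congr rfl fun n _ => ?_
    rw [map_smul]
    ext k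
    simp only [lp.single_apply, lp.coeFn_smul, Pi.smul_apply, coeffLp_apply,
      fourierCoeff_fourier, smul_eq_mul]
    by_cases hk : k = n
    · subst hk; simp
    · simp [Pi.single_eq_of_ne hk]
  have herr : ‖coeffLp p (∑ i ∈ s, c i • (fourier (M * κ i) * u i)) - main‖ ≤ ε := by
    rw [hmain, Finset.sum_product]
    simp only [hshift]
    rw [map_sum, ← Finset.sum_sub_distrib]
    refine (norm_sum_le _ _).trans ?_
    calc _ ≤ ∑ i ∈ s, ‖c i‖ * (ε / (A + 1)) := by
          refine Finset.sum_le_sum fun i hi => ?_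
          rw [← map_sub, ← smul_sub, ← mul_sub, map_smul, norm_smul, norm_coeffLp_fourier_mul,
            map_sub, htr]
          gcongr
          exact hW i hi
      _ = A / (A + 1) * ε := by rw [← Finset.sum_mul, ← hA]; ring
      _ ≤ 1 * ε := by gcongr; rw [div_le_one (by positivity)]; linarith
      _ = ε := one_mul ε
  calc _ ≤ ‖main‖ + ‖coeffLp p (∑ i ∈ s, c i • (fourier (M * κ i) * u i)) - main‖ := by
        rw [add_comm]; exact norm_le_norm_sub_add _ _
    _ ≤ _ := add_le_add hmain_le herr

/-! ### A signed measure with vanishing moments -/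

/-- At m = n this is the constant that normalises the weights below; its explicit value bounds their
total variation. -/
theorem fwdDiff_iter_inv (n m : ℕ) (hm : 0 < m) :
    (fwdDiff 1)^[n] (fun k : ℕ => (k : ℝ)⁻¹) m
      = (-1) ^ n * (n.factorial : ℝ) / (m.ascFactorial (n + 1) : ℝ) := by
  induction n generalizing m with
  | zero => simp [Nat.ascFactorial_succ]
  | succ n ih =>
    rw [Function.iterate_succ_apply', fwdDiff, ih (m + 1) (by omega), ih m hm]
    have h1 : (m : ℝ) * ((m + 1).ascFactorial n : ℝ) = (m + n) * (m.ascFactorial n : ℝ) := by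
      exact_mod_cast Nat.succ_ascFactorial m n
    have hpos : (0 : ℝ) < m.ascFactorial n := by
      obtain ⟨k, rfl⟩ : ∃ k, m = k + 1 := ⟨m - 1, by omega⟩
      exact_mod_cast Nat.ascFactorial_pos k n
    have hm' : (0 : ℝ) < m := by exact_mod_cast hm
    have h2 : ((m + 1).ascFactorial n : ℝ) = (m + n) * (m.ascFactorial n : ℝ) / m := by
      field_simp; linarith
    simp only [Nat.ascFactorial_succ, Nat.factorial_succ, Nat.cast_mul, Nat.cast_add,
      Nat.cast_one, pow_succ]
    rw [h2]
    field_simp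
    ring

/-- A signed measure of mass one on `[η/2, η]` whose first `n` moments vanish. -/
theorem exists_weights_vanishing_moments {n : ℕ} (hn : 1 ≤ n) {η : ℝ} (hη : 0 < η) :
    ∃ ρ s : ℕ → ℝ, (∀ i ∈ Finset.range (n + 1), η / 2 ≤ s i ∧ s i ≤ η) ∧
      ∑ i ∈ Finset.range (n + 1), ρ i = 1 ∧
      (∀ k, 1 ≤ k → k ≤ n → ∑ i ∈ Finset.range (n + 1), ρ i * s i ^ k = 0) ∧
      ∑ i ∈ Finset.range (n + 1), |ρ i| ≤ 8 ^ n := by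
  have hn0 : (0 : ℝ) < n := by exact_mod_cast hn
  set Z : ℝ := (-1) ^ n * (n.factorial : ℝ) / (n.ascFactorial (n + 1) : ℝ) with hZ
  have hZsum : ∑ k ∈ Finset.range (n + 1),
      (-1 : ℝ) ^ (n - k) * (n.choose k : ℝ) * ((n : ℝ) + k)⁻¹ = Z := by
    rw [hZ, ← fwdDiff_iter_inv n n (by omega), fwdDiff_iter_eq_sum_shift]
    simp
  have hasc : (n.ascFactorial (n + 1) : ℝ) = n * (n.factorial * ((n + n).choose n : ℝ)) := by
    have h1 : n * (n + 1).ascFactorial n = n.ascFactorial (n + 1) := Nat.succ_ascFactorial n n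
    rw [← h1, Nat.ascFactorial_eq_factorial_mul_choose]
    push_cast
    ring
  have hf0 : (0 : ℝ) < n.factorial := by exact_mod_cast n.factorial_pos
  have hc0 : (0 : ℝ) < ((n + n).choose n : ℝ) := by exact_mod_cast Nat.choose_pos (by omega)
  have hZabs : |Z|⁻¹ = n * ((n + n).choose n : ℝ) := by
    rw [hZ, hasc, abs_div, abs_mul, abs_pow, abs_neg, abs_one, one_pow, one_mul,
      abs_of_pos hf0, abs_of_pos (by positivity)]
    field_simp
  have hZ0 : Z ≠ 0 := by
    intro h
    rw [h, abs_zero, inv_zero] at hZabs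
    have : 0 < n * ((n + n).choose n : ℝ) := by positivity
    linarith
  have hc4 : ((n + n).choose n : ℝ) ≤ 4 ^ n := by
    have : (n + n).choose n ≤ 2 ^ (n + n) := Nat.choose_le_two_pow _ _
    have h4 : (2 : ℕ) ^ (n + n) = 4 ^ n := by rw [← two_mul, pow_mul]; norm_num
    rw [h4] at this
    exact_mod_cast this
  -- The weights are those of the n-th difference, divided by the node n + k. The mass is then the
  -- n-th difference of 1/x over Z, and a moment of order j + 1 ≤ n is a multiple of the n-th
  -- difference of x^j, hence 0. The total variation is at most 2^n · 4^n, by the row sum and the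
  -- central binomial coefficient.
  refine ⟨fun k => (-1 : ℝ) ^ (n - k) * (n.choose k : ℝ) * ((n : ℝ) + k)⁻¹ / Z,
    fun k => η / (2 * n) * (n + k), ?_, ?_, ?_, ?_⟩
  · intro i hi
    have hi' : (i : ℝ) ≤ n := by exact_mod_cast Nat.lt_succ_iff.mp (Finset.mem_range.mp hi)
    have hi0 : (0 : ℝ) ≤ i := by positivity
    beta_reduce
    constructor
    · rw [div_mul_eq_mul_div, div_le_div_iff₀ (by positivity) (by positivity)]
      nlinarith [mul_nonneg hη.le hi0]
    · rw [div_mul_eq_mul_div, div_le_iff₀ (by positivity)]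
      nlinarith
  · rw [← Finset.sum_div, hZsum, div_self hZ0]
  · intro k hk hkn
    obtain ⟨j, rfl⟩ : ∃ j, k = j + 1 := ⟨k - 1, by omega⟩
    have h := congrFun (fwdDiff_iter_pow_eq_zero_of_lt (R := ℝ) (show j < n by omega)) (n : ℝ)
    rw [fwdDiff_iter_eq_sum_shift] at h
    simp only [nsmul_eq_mul, mul_one, zsmul_eq_mul, Int.cast_mul, Int.cast_pow, Int.cast_neg,
      Int.cast_one, Int.cast_natCast, Pi.zero_apply] at h
    have h' : ∑ i ∈ Finset.range (n + 1), (-1 : ℝ) ^ (n - i) * (n.choose i : ℝ)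
        * ((n : ℝ) + i)⁻¹ / Z * (η / (2 * n) * (n + i)) ^ (j + 1)
        = (η / (2 * n)) ^ (j + 1) / Z * ∑ i ∈ Finset.range (n + 1),
          (-1 : ℝ) ^ (n - i) * (n.choose i : ℝ) * (n + i) ^ j := by
      rw [Finset.mul_sum]
      refine Finset.sum_congr rfl fun i _ => ?_
      have : (n : ℝ) + i ≠ 0 := by positivity
      rw [mul_pow, pow_succ ((n : ℝ) + i)]
      field_simp
    rw [h', h, mul_zero]
  · have hterm : ∀ i ∈ Finset.range (n + 1),
        |(-1 : ℝ) ^ (n - i) * (n.choose i : ℝ) * ((n : ℝ) + i)⁻¹ / Z|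
          ≤ (n.choose i : ℝ) * 4 ^ n := by
      intro i _
      rw [div_eq_mul_inv, abs_mul, abs_mul, abs_mul, abs_pow, abs_neg, abs_one, one_pow, one_mul,
        abs_inv Z, hZabs, abs_of_nonneg (by positivity : (0 : ℝ) ≤ n.choose i),
        abs_of_nonneg (by positivity : (0 : ℝ) ≤ ((n : ℝ) + i)⁻¹), mul_assoc]
      gcongr
      calc ((n : ℝ) + i)⁻¹ * (n * ((n + n).choose n : ℝ))
          ≤ (n : ℝ)⁻¹ * (n * ((n + n).choose n : ℝ)) := by
            gcongr
            have : (0 : ℝ) ≤ i := by positivity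
            linarith
        _ = ((n + n).choose n : ℝ) := by field_simp
        _ ≤ 4 ^ n := hc4
    refine (Finset.sum_le_sum hterm).trans ?_
    rw [← Finset.sum_mul]
    have : ∑ i ∈ Finset.range (n + 1), (n.choose i : ℝ) = 2 ^ n := by
      exact_mod_cast Nat.sum_range_choose n
    rw [this, ← mul_pow]
    norm_num

/-! ### Riesz-type products and their expansion -/

/-- To second order the left side is exp(s x - s²/4); weakening 1/4 to 1/5 leaves room for the cubic
Taylor error. The gain s²/5 at each factor is what makes the product small. -/
theorem abs_factor_le_exp {x s : ℝ} (hx : |x| ≤ 1) (hs0 : 0 ≤ s) (hs : s ≤ 1 / 10) :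
    |1 + s * x + s ^ 2 / 4 * (2 * x ^ 2 - 1)| ≤ Real.exp (s * x - s ^ 2 / 5) := by
  obtain ⟨hx1, hx2⟩ := abs_le.mp hx
  set y := s * x - s ^ 2 / 5 with hy
  have hy1 : |y| ≤ 11 / 10 * s := by
    rw [abs_le]
    constructor <;> nlinarith
  have hy' : |y| ≤ 1 := by linarith
  have hpos : 0 ≤ 1 + s * x + s ^ 2 / 4 * (2 * x ^ 2 - 1) := by nlinarith [sq_nonneg (s * x)]
  rw [abs_of_nonneg hpos]
  have h := Real.exp_bound hy' (n := 3) (by norm_num)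
  simp only [Finset.sum_range_succ, Finset.sum_range_zero] at h
  norm_num [Nat.factorial] at h
  have h3 : |y| ^ 3 ≤ (11 / 10 * s) ^ 3 := pow_le_pow_left₀ (abs_nonneg _) hy1 3
  have h4 := (abs_le.mp h).1
  have h5 : s ^ 3 * x ≤ s ^ 3 := by nlinarith [pow_nonneg hs0 3]
  have h6 : s ^ 3 ≤ s ^ 2 / 10 := by nlinarith [pow_nonneg hs0 2]
  have h7 : y ^ 2 = s ^ 2 * x ^ 2 - 2 / 5 * (s ^ 3 * x) + s ^ 4 / 25 := by rw [hy]; ring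
  have h8 : 0 ≤ s ^ 4 := by positivity
  nlinarith

/-- The absolute value of the digit `d - 2`. -/
def absDigit : Fin 5 → ℕ := ![2, 1, 0, 1, 2]

/-- The weight of the digit `d - 2` in a single factor of the product. -/
noncomputable def digitWeight : Fin 5 → ℝ := ![1 / 8, 1 / 2, 1, 1 / 2, 1 / 8]

/-- The power `v ^ (d - 2)` of a unimodular function. -/
noncomputable def digitPow (v : C(Torus, ℂ)) : Fin 5 → C(Torus, ℂ) :=
  ![star v ^ 2, star v, 1, v, v ^ 2]

/-- The frequency with base-five digits `θ j - 2`. -/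
def digitFreq {N : ℕ} (θ : Fin N → Fin 5) : ℤ := ∑ j : Fin N, 5 ^ (j : ℕ) * (((θ j : ℕ) : ℤ) - 2)

/-- One factor of the product: `1 + s Re z + s² / 4 * Re z²`. -/
noncomputable def factor (s : ℝ) (z : C(Torus, ℂ)) : C(Torus, ℂ) :=
  ∑ d, ((s ^ absDigit d * digitWeight d : ℝ) : ℂ) • digitPow z d

/-- Adding the constant ∑ 2 · 5^j turns balanced digits into ordinary base-five digits. -/
theorem digitFreq_injective (N : ℕ) : Function.Injective (digitFreq (N := N)) := by
  intro θ φ h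
  apply finFunctionFinEquiv.injective
  apply Fin.ext
  rw [finFunctionFinEquiv_apply, finFunctionFinEquiv_apply]
  have key : ∀ θ : Fin N → Fin 5, ((∑ j : Fin N, (θ j : ℕ) * 5 ^ (j : ℕ) : ℕ) : ℤ)
      = digitFreq θ + ∑ j : Fin N, 2 * 5 ^ (j : ℕ) := by
    intro θ
    rw [digitFreq, ← Finset.sum_add_distrib]
    push_cast
    exact Finset.sum_congr rfl fun j _ => by ring
  exact_mod_cast (key θ).trans (h ▸ (key φ).symm)

theorem star_fourier (n : ℤ) : star (fourier n : C(Torus, ℂ)) = fourier (-n) := by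
  ext t; simp only [ContinuousMap.star_apply, fourier_neg]; rfl

theorem fourier_mul_fourier (m n : ℤ) :
    (fourier m * fourier n : C(Torus, ℂ)) = fourier (m + n) := by
  ext t; rw [ContinuousMap.mul_apply, ← fourier_add]

theorem fourier_zero_eq_one : (fourier 0 : C(Torus, ℂ)) = 1 := by
  ext t; simp

theorem prod_fourier {ι : Type*} (s : Finset ι) (k : ι → ℤ) :
    ∏ i ∈ s, (fourier (k i) : C(Torus, ℂ)) = fourier (∑ i ∈ s, k i) := by
  classical
  induction s using Finset.induction_on with
  | empty => simp [fourier_zero_eq_one]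
  | insert a s ha ih => rw [Finset.prod_insert ha, Finset.sum_insert ha, ih, fourier_mul_fourier]

theorem digitPow_mul_fourier (v : C(Torus, ℂ)) (n : ℤ) (d : Fin 5) :
    digitPow (v * fourier n) d = fourier (n * (((d : ℕ) : ℤ) - 2)) * digitPow v d := by
  have h1 : star (v * fourier n) = star v * fourier (-n) := by
    rw [star_mul, star_fourier]; exact mul_comm _ _
  fin_cases d <;> simp only [digitPow, h1, mul_pow, sq (fourier _ : C(Torus, ℂ)),
    fourier_mul_fourier]
  · simp [mul_comm]; ring_nf
  · simp [mul_comm]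
  · simp [fourier_zero_eq_one]
  · simp [mul_comm]
  · simp [mul_comm]; ring_nf

theorem norm_digitPow_le {v : C(Torus, ℂ)} (hv : ∀ t, ‖v t‖ = 1) (d : Fin 5) :
    ‖digitPow v d‖ ≤ 1 := by
  rw [ContinuousMap.norm_le _ zero_le_one]
  intro t
  fin_cases d <;> simp [digitPow, hv]

theorem prod_factor {N : ℕ} (s : ℝ) (v : C(Torus, ℂ)) (M : ℤ) :
    ∏ j : Fin N, factor s (v * fourier (M * 5 ^ (j : ℕ)))
      = ∑ θ : Fin N → Fin 5, ((s ^ (∑ j, absDigit (θ j)) * ∏ j, digitWeight (θ j) : ℝ) : ℂ) •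
        (fourier (M * digitFreq θ) * ∏ j, digitPow v (θ j)) := by
  simp only [factor]
  rw [Finset.prod_univ_sum, Fintype.piFinset_univ]
  refine Finset.sum_congr rfl fun θ _ => ?_
  rw [Finset.prod_smul, Finset.prod_congr rfl fun j _ => digitPow_mul_fourier v _ (θ j),
    Finset.prod_mul_distrib, prod_fourier, ← Complex.ofReal_prod, Finset.prod_mul_distrib,
    Finset.prod_pow_eq_pow_sum, digitFreq, Finset.mul_sum]
  simp only [mul_assoc]

theorem factor_apply {s : ℝ} {z : C(Torus, ℂ)} {t : Torus} (hz : ‖z t‖ = 1) :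
    factor s z t = ((1 + s * (z t).re + s ^ 2 / 4 * (2 * (z t).re ^ 2 - 1) : ℝ) : ℂ) := by
  have h : (z t).re ^ 2 + (z t).im ^ 2 = 1 := by
    have := Complex.sq_norm (z t)
    rw [hz, Complex.normSq_apply] at this
    nlinarith
  simp only [factor, Fin.sum_univ_five, digitPow, absDigit, digitWeight]
  simp
  apply Complex.ext
  · simp [pow_two]
    nlinarith
  · simp [pow_two]
    ring

/-- The sum is 1 + y + y²/4. It is one factor of the generating function of the coefficients by
degree. -/
theorem sum_digitWeight_le_exp {y : ℝ} (hy : 0 ≤ y) :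
    ∑ d, digitWeight d * y ^ absDigit d ≤ Real.exp y := by
  have h := Real.quadratic_le_exp_of_nonneg hy
  simp [Fin.sum_univ_five, digitWeight, absDigit]
  nlinarith [sq_nonneg y]

theorem digitWeight_nonneg (d : Fin 5) : 0 ≤ digitWeight d := by
  fin_cases d <;> simp [digitWeight]

theorem digitWeight_le_one (d : Fin 5) : digitWeight d ≤ 1 := by
  fin_cases d <;> simp [digitWeight] <;> norm_num

theorem exists_cutoff {w : C(Torus, ℂ)} (hw : w ∈ Test) {a : ℝ} (ha : 0 < a) :
    ∃ ψ ∈ Test, (∀ t, ‖1 - ψ t‖ ≤ 1) ∧ (∀ t, ψ t ≠ 0 → a / 2 ≤ (w t).re) ∧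
      ∀ t, a ≤ (w t).re → ψ t = 1 := by
  refine ⟨⟨fun t => ((Real.smoothTransition (((w t).re - a / 2) / (a / 2)) : ℝ) : ℂ), ?_⟩,
    ?_, ?_, ?_, ?_⟩
  · have := Real.smoothTransition.continuous
    fun_prop
  · refine mem_test_of_contDiff ?_
    have h1 : ContDiff ℝ ∞ fun x : ℝ => (periodize w x).re :=
      Complex.reCLM.contDiff.comp (contDiff_periodize hw)
    have h2 : ContDiff ℝ ∞ fun x : ℝ => ((periodize w x).re - a / 2) / (a / 2) :=
      (h1.sub contDiff_const).div_const _
    exact Complex.ofRealCLM.contDiff.comp (Real.smoothTransition.contDiff.comp h2)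
  · intro t
    simp only [ContinuousMap.coe_mk]
    rw [← Complex.ofReal_one, ← Complex.ofReal_sub, Complex.norm_real, Real.norm_eq_abs, abs_le]
    constructor
    · linarith [Real.smoothTransition.le_one (((w t).re - a / 2) / (a / 2))]
    · linarith [Real.smoothTransition.nonneg (((w t).re - a / 2) / (a / 2))]
  · intro t ht
    by_contra! hlt
    refine ht ?_
    simp only [ContinuousMap.coe_mk]
    rw [Real.smoothTransition.zero_of_nonpos, Complex.ofReal_zero]
    exact div_nonpos_of_nonpos_of_nonneg (by linarith) (by linarith)
  · intro t ht
    simp only [ContinuousMap.coe_mk]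
    rw [Real.smoothTransition.one_of_one_le, Complex.ofReal_one]
    rw [le_div_iff₀ (by linarith)]
    linarith

theorem one_le_sum_absDigit {N : ℕ} {θ : Fin N → Fin 5} (hθ : θ ≠ fun _ => 2) :
    1 ≤ ∑ j, absDigit (θ j) := by
  obtain ⟨j, hj⟩ := Function.ne_iff.mp hθ
  have h1 : ∀ d : Fin 5, d ≠ 2 → 1 ≤ absDigit d := by decide
  exact (h1 _ hj).trans (Finset.single_le_sum (f := fun j => absDigit (θ j))
    (fun _ _ => Nat.zero_le _) (Finset.mem_univ j))

/-- The `ℓ^q` sum of the coefficients of an average of products, when the low moments vanish. -/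
theorem sum_rpow_moment_le {n N : ℕ} {ρ s : ℕ → ℝ} {η q L : ℝ} (hη : 0 < η) (hq : 1 ≤ q)
    (hL : 1 ≤ L) (hs : ∀ i ∈ Finset.range (n + 1), η / 2 ≤ s i ∧ s i ≤ η)
    (hmom : ∀ k, 1 ≤ k → k ≤ n → ∑ i ∈ Finset.range (n + 1), ρ i * s i ^ k = 0)
    (hvar : ∑ i ∈ Finset.range (n + 1), |ρ i| ≤ 8 ^ n) :
    ∑ θ ∈ Finset.univ.erase (fun _ : Fin N => (2 : Fin 5)),
      |(∑ i ∈ Finset.range (n + 1), ρ i * s i ^ (∑ j, absDigit (θ j)))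
        * ∏ j, digitWeight (θ j)| ^ q
      ≤ ((8 : ℝ) ^ q) ^ n * L⁻¹ ^ n * Real.exp (L * η ^ q) ^ N := by
  have hq0 : 0 ≤ q := by linarith
  have hL0 : 0 < L := by linarith
  have hηq : 0 ≤ η ^ q := Real.rpow_nonneg hη.le q
  have hterm : ∀ θ ∈ Finset.univ.erase (fun _ : Fin N => (2 : Fin 5)),
      |(∑ i ∈ Finset.range (n + 1), ρ i * s i ^ (∑ j, absDigit (θ j)))
        * ∏ j, digitWeight (θ j)| ^ q
      ≤ ((8 : ℝ) ^ q) ^ n * L⁻¹ ^ n *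
        ∏ j, (digitWeight (θ j) * (L * η ^ q) ^ absDigit (θ j)) := by
    intro θ hθ
    have hw0 : 0 ≤ ∏ j, digitWeight (θ j) :=
      Finset.prod_nonneg fun j _ => digitWeight_nonneg _
    have hw1 : ∏ j, digitWeight (θ j) ≤ 1 :=
      Finset.prod_le_one (fun j _ => digitWeight_nonneg _) fun j _ => digitWeight_le_one _
    have hk1 := one_le_sum_absDigit (Finset.ne_of_mem_erase hθ)
    rw [Finset.prod_mul_distrib, Finset.prod_pow_eq_pow_sum]
    set k := ∑ j, absDigit (θ j)
    rcases le_or_gt k n with hkn | hkn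
    · rw [hmom k hk1 hkn, zero_mul, abs_zero, Real.zero_rpow (by linarith)]
      positivity
    · have hm : |∑ i ∈ Finset.range (n + 1), ρ i * s i ^ k| ≤ 8 ^ n * η ^ k := by
        refine (Finset.abs_sum_le_sum_abs _ _).trans ?_
        calc ∑ i ∈ Finset.range (n + 1), |ρ i * s i ^ k|
            ≤ ∑ i ∈ Finset.range (n + 1), |ρ i| * η ^ k := by
              refine Finset.sum_le_sum fun i hi => ?_
              have h0 : 0 ≤ s i := by linarith [(hs i hi).1]
              rw [abs_mul, abs_of_nonneg (pow_nonneg h0 k)]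
              gcongr
              exact (hs i hi).2
          _ ≤ 8 ^ n * η ^ k := by rw [← Finset.sum_mul]; gcongr
      calc _ ≤ (8 ^ n * η ^ k * ∏ j, digitWeight (θ j)) ^ q := by
            rw [abs_mul, abs_of_nonneg hw0]
            have := pow_nonneg hη.le k
            gcongr
        _ = ((8 : ℝ) ^ q) ^ n * (η ^ q) ^ k * (∏ j, digitWeight (θ j)) ^ q := by
            rw [Real.mul_rpow (by positivity) hw0, Real.mul_rpow (by positivity) (by positivity),
              Real.rpow_pow_comm (by norm_num), Real.rpow_pow_comm hη.le]
        _ ≤ ((8 : ℝ) ^ q) ^ n * (η ^ q) ^ k * ∏ j, digitWeight (θ j) := by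
            gcongr
            exact Real.rpow_le_self_of_le_one hw0 hw1 hq
        -- Only degrees k > n survive, so inserting L^(k - n) ≥ 1 is free. It produces the gain L⁻ⁿ,
        -- and the sum over all digits then factorises.
        _ ≤ ((8 : ℝ) ^ q) ^ n * (L⁻¹ ^ n * (L * η ^ q) ^ k) * ∏ j, digitWeight (θ j) := by
            gcongr
            rw [mul_pow, ← mul_assoc, inv_pow]
            refine le_mul_of_one_le_left (by positivity) ?_
            rw [inv_mul_eq_div, one_le_div (by positivity)]
            exact pow_le_pow_right₀ hL hkn.le
        _ = _ := by ring
  refine (Finset.sum_le_sum hterm).trans ?_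
  rw [← Finset.mul_sum]
  gcongr
  calc ∑ θ ∈ Finset.univ.erase (fun _ : Fin N => (2 : Fin 5)),
        ∏ j, (digitWeight (θ j) * (L * η ^ q) ^ absDigit (θ j))
      ≤ ∑ θ : Fin N → Fin 5, ∏ j, (digitWeight (θ j) * (L * η ^ q) ^ absDigit (θ j)) := by
        refine Finset.sum_le_sum_of_subset_of_nonneg (Finset.erase_subset _ _) fun θ _ _ => ?_
        exact Finset.prod_nonneg fun j _ =>
          mul_nonneg (digitWeight_nonneg _) (pow_nonneg (by positivity) _)
    _ = ∏ _j : Fin N, ∑ d, digitWeight d * (L * η ^ q) ^ absDigit d := by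
        rw [Finset.prod_univ_sum, Fintype.piFinset_univ]
    _ ≤ Real.exp (L * η ^ q) ^ N := by
        rw [Finset.prod_const, Finset.card_univ, Fintype.card_fin]
        refine pow_le_pow_left₀ ?_ (sum_digitWeight_le_exp (by positivity)) N
        exact Finset.sum_nonneg fun d _ =>
          mul_nonneg (digitWeight_nonneg _) (pow_nonneg (by positivity) _)

/-- The average over `i` of the products `∏ j, factor (s i) (v * exp (i M 5^j t))`. -/
noncomputable def averagedProduct (n N : ℕ) (ρ s : ℕ → ℝ) (v : C(Torus, ℂ)) (M : ℤ) :
    C(Torus, ℂ) :=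
  ∑ i ∈ Finset.range (n + 1), (ρ i : ℂ) • ∏ j : Fin N, factor (s i) (v * fourier (M * 5 ^ (j : ℕ)))

/-- The digit 2 stands for exponent 0, so the constant word 2 contributes the total mass, which is
1, and cancels. -/
theorem averagedProduct_sub_one {n N : ℕ} {ρ s : ℕ → ℝ}
    (hρ : ∑ i ∈ Finset.range (n + 1), ρ i = 1) (v : C(Torus, ℂ)) (M : ℤ) :
    averagedProduct n N ρ s v M - 1 =
      ∑ θ ∈ Finset.univ.erase (fun _ : Fin N => (2 : Fin 5)),
        (((∑ i ∈ Finset.range (n + 1), ρ i * s i ^ (∑ j, absDigit (θ j)))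
          * ∏ j, digitWeight (θ j) : ℝ) : ℂ) •
        (fourier (M * digitFreq θ) * ∏ j, digitPow v (θ j)) := by
  have h : averagedProduct n N ρ s v M = ∑ θ : Fin N → Fin 5,
      (((∑ i ∈ Finset.range (n + 1), ρ i * s i ^ (∑ j, absDigit (θ j)))
          * ∏ j, digitWeight (θ j) : ℝ) : ℂ) •
        (fourier (M * digitFreq θ) * ∏ j, digitPow v (θ j)) := by
    simp only [averagedProduct, prod_factor, Finset.smul_sum, smul_smul]
    rw [Finset.sum_comm]
    refine Finset.sum_congr rfl fun θ _ => ?_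
    rw [← Finset.sum_smul]
    congr 1
    push_cast
    rw [Finset.sum_mul]
    exact Finset.sum_congr rfl fun i _ => by ring
  rw [h, ← Finset.add_sum_erase _ _ (Finset.mem_univ (fun _ : Fin N => (2 : Fin 5)))]
  have h0 : absDigit 2 = 0 := rfl
  have h1 : digitWeight 2 = 1 := rfl
  have h2 : digitPow v 2 = 1 := rfl
  have h3 : digitFreq (fun _ : Fin N => (2 : Fin 5)) = 0 := by simp [digitFreq]
  simp only [h0, h1, h2, h3, Finset.sum_const_zero, pow_zero, mul_one, hρ, Finset.prod_const_one,
    mul_zero, fourier_zero_eq_one, Complex.ofReal_one, one_smul, add_sub_cancel_left]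

theorem digitPow_mem_test {v : C(Torus, ℂ)} (hv : v ∈ Test) (d : Fin 5) :
    digitPow v d ∈ Test := by
  have h := star_mem_test hv
  fin_cases d <;> simp only [digitPow, sq]
  · exact mul_mem_test h h
  · exact h
  · exact one_mem_test
  · exact hv
  · exact mul_mem_test hv hv

theorem averagedProduct_mem_test {n N : ℕ} {ρ s : ℕ → ℝ} {v : C(Torus, ℂ)} (hv : v ∈ Test)
    (M : ℤ) : averagedProduct n N ρ s v M ∈ Test := by
  refine Submodule.sum_mem _ fun i _ => Submodule.smul_mem _ _ (prod_mem_test _ fun j _ => ?_)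
  refine Submodule.sum_mem _ fun d _ => Submodule.smul_mem _ _ (digitPow_mem_test ?_ d)
  exact mul_mem_test hv (fourier_mem_test _)

/-- Since s ≥ η/2, the linear term s η N/20 is at most s² N/10, half of the gain s² N/5. What
remains is at least η² N/40. -/
theorem norm_averagedProduct_apply_le {n N : ℕ} {ρ s : ℕ → ℝ} {η : ℝ} (hη : 0 < η)
    (hη' : η ≤ 1 / 10) (hs : ∀ i ∈ Finset.range (n + 1), η / 2 ≤ s i ∧ s i ≤ η)
    (hvar : ∑ i ∈ Finset.range (n + 1), |ρ i| ≤ 8 ^ n) {v : C(Torus, ℂ)} (hv : ∀ t, ‖v t‖ = 1)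
    (M : ℤ) {t : Torus}
    (ht : ∑ j : Fin N, ((v * fourier (M * 5 ^ (j : ℕ)) : C(Torus, ℂ)) t).re ≤ η / 20 * N) :
    ‖averagedProduct n N ρ s v M t‖ ≤ 8 ^ n * Real.exp (-(η ^ 2 / 40 * N)) := by
  have hz : ∀ k, ‖(v * fourier k : C(Torus, ℂ)) t‖ = 1 := fun k => by
    rw [ContinuousMap.mul_apply, norm_mul, hv, fourier_apply, Circle.norm_coe, one_mul]
  have hprod : ∀ i ∈ Finset.range (n + 1),
      ‖(∏ j : Fin N, factor (s i) (v * fourier (M * 5 ^ (j : ℕ)))) t‖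
        ≤ Real.exp (-(η ^ 2 / 40 * N)) := by
    intro i hi
    obtain ⟨h1, h2⟩ := hs i hi
    have h0 : 0 ≤ s i := by linarith
    rw [ContinuousMap.prod_apply, norm_prod]
    calc _ ≤ ∏ j : Fin N, Real.exp (s i * ((v * fourier (M * 5 ^ (j : ℕ)) : C(Torus, ℂ)) t).re
            - s i ^ 2 / 5) := by
          refine Finset.prod_le_prod (fun _ _ => norm_nonneg _) fun j _ => ?_
          rw [factor_apply (hz _), Complex.norm_real, Real.norm_eq_abs]
          refine abs_factor_le_exp ?_ h0 (by linarith)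
          exact (Complex.abs_re_le_norm _).trans (hz _).le
      _ = Real.exp (s i * ∑ j : Fin N, ((v * fourier (M * 5 ^ (j : ℕ)) : C(Torus, ℂ)) t).re
            - s i ^ 2 / 5 * N) := by
          rw [← Real.exp_sum, Finset.sum_sub_distrib, ← Finset.mul_sum]
          simp [mul_comm]
      _ ≤ _ := by
          rw [Real.exp_le_exp]
          have hN : (0 : ℝ) ≤ N := by positivity
          have h3 : s i * ∑ j : Fin N, ((v * fourier (M * 5 ^ (j : ℕ)) : C(Torus, ℂ)) t).re
              ≤ s i * (η / 20 * N) := by gcongr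
          have h4 : s i * η ≤ 2 * s i ^ 2 := by nlinarith
          have h5 : η ^ 2 ≤ 4 * s i ^ 2 := by nlinarith
          have h6 : s i * (η / 20 * N) ≤ s i ^ 2 / 10 * N := by
            calc s i * (η / 20 * N) = s i * η / 20 * N := by ring
              _ ≤ 2 * s i ^ 2 / 20 * N := by gcongr
              _ = _ := by ring
          have h7 : η ^ 2 / 40 * N ≤ s i ^ 2 / 10 * N := by
            calc η ^ 2 / 40 * N ≤ 4 * s i ^ 2 / 40 * N := by gcongr
              _ = _ := by ring
          linarith
  rw [averagedProduct, ContinuousMap.sum_apply]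
  refine (norm_sum_le _ _).trans ?_
  calc _ ≤ ∑ i ∈ Finset.range (n + 1), |ρ i| * Real.exp (-(η ^ 2 / 40 * N)) := by
        refine Finset.sum_le_sum fun i hi => ?_
        rw [ContinuousMap.smul_apply, norm_smul, Complex.norm_real, Real.norm_eq_abs]
        gcongr
        exact hprod i hi
    _ ≤ _ := by rw [← Finset.sum_mul]; gcongr

/-! ### Choice of parameters and the multiplier -/

/-- With η = (L R)^(-1/q), the quantity η² R is a constant times R^(1 - 2/q), which is unbounded
exactly because q > 2. -/
theorem exists_parameters {q : ℝ} (hq : 2 < q) {L : ℝ} (hL : 1 ≤ L) :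
    ∃ (R : ℕ) (η : ℝ), 0 < R ∧ 0 < η ∧ η ≤ 1 / 10 ∧ L * η ^ q * R = 1 ∧ 160 ≤ η ^ 2 * R := by
  have hq0 : 0 < q := by linarith
  have hL0 : 0 < L := by linarith
  have h1 : Filter.Tendsto (fun R : ℕ => (L * (R : ℝ)) ^ (-(1 / q))) Filter.atTop (nhds 0) :=
    (tendsto_rpow_neg_atTop (by positivity)).comp
      (tendsto_natCast_atTop_atTop.const_mul_atTop hL0)
  have h2 : Filter.Tendsto (fun R : ℕ => L ^ (-(2 / q)) * (R : ℝ) ^ (1 - 2 / q))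
      Filter.atTop Filter.atTop := by
    refine Filter.Tendsto.const_mul_atTop (by positivity) ?_
    refine (tendsto_rpow_atTop ?_).comp tendsto_natCast_atTop_atTop
    rw [sub_pos, div_lt_one hq0]
    exact hq
  obtain ⟨R, hR1, hR2, hR0⟩ := ((h1.eventually (eventually_le_nhds
    (by norm_num : (0 : ℝ) < 1 / 10))).and ((h2.eventually_ge_atTop 160).and (Filter.eventually_gt_atTop 0))).exists
  have hR : (0 : ℝ) < R := by exact_mod_cast hR0
  refine ⟨R, (L * (R : ℝ)) ^ (-(1 / q)), hR0, by positivity, hR1, ?_, ?_⟩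
  · rw [← Real.rpow_mul (by positivity)]
    have : -(1 / q) * q = -1 := by field_simp
    rw [this, Real.rpow_neg_one]
    field_simp
  · have h3 : ((L * (R : ℝ)) ^ (-(1 / q))) ^ 2 * R = L ^ (-(2 / q)) * (R : ℝ) ^ (1 - 2 / q) := by
      rw [← Real.rpow_natCast, ← Real.rpow_mul (by positivity),
        Real.mul_rpow hL0.le hR.le, mul_assoc, sub_eq_add_neg, Real.rpow_add hR, Real.rpow_one]
      have : -(1 / q) * ((2 : ℕ) : ℝ) = -(2 / q) := by push_cast; ring
      rw [this]
      ring
    rw [h3]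
    exact hR2

/-- Smooth multipliers close to `1` in `ℓ^p` norm and supported where `v` correlates with an
average of exponentials. -/
theorem exists_multiplier (p : ℝ≥0∞) [Fact (1 ≤ p)] [Fact (2 ≤ p)] [Fact (p ≠ ⊤)]
    (hp : 2 < p.toReal) :
    ∃ c : ℝ, 0 < c ∧ c ≤ 1 ∧ ∀ v ∈ Test, (∀ t, ‖v t‖ = 1) → ∀ ε : ℝ, 0 < ε →
      ∃ F ∈ Test, ∃ (N : ℕ) (ν : Fin N → ℤ), 0 < N ∧ ‖coeffLp p (F - 1)‖ < ε ∧
        ∀ t, F t ≠ 0 → c * N ≤ ∑ j, ((v * fourier (ν j) : C(Torus, ℂ)) t).re := by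
  set q := p.toReal with hqdef
  have hq0 : 0 < q := by linarith
  -- L⁻ⁿ absorbs the variation 8^(qn) and the growth exp(L η^q N) = e^n, leaving e^(-n).
  set L : ℝ := (8 : ℝ) ^ q * Real.exp 1 ^ 2 with hL
  have hL1 : 1 ≤ L := by
    have h1 : (1 : ℝ) ≤ 8 ^ q := Real.one_le_rpow (by norm_num) hq0.le
    have h2 : (1 : ℝ) ≤ Real.exp 1 ^ 2 := one_le_pow₀ (Real.one_le_exp zero_le_one)
    rw [hL]; nlinarith
  obtain ⟨R, η, hR, hη, hη', hLR, hηR⟩ := exists_parameters hp hL1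
  -- Half of the cutoff threshold η/20. It is fixed before `v` and `ε`; only n, and with it N = R n,
  -- depends on the accuracy.
  refine ⟨η / 40, by positivity, by linarith, fun v hv hv1 ε hε => ?_⟩
  -- the number of vanishing moments
  have hlim1 : Filter.Tendsto (fun n : ℕ => Real.exp (-(n : ℝ))) Filter.atTop (nhds 0) :=
    Real.tendsto_exp_neg_atTop_nhds_zero.comp tendsto_natCast_atTop_atTop
  have hlim2 : Filter.Tendsto (fun n : ℕ => Real.exp (-(n : ℝ)) ^ (1 / q)) Filter.atTop
      (nhds 0) := by
    have := hlim1.rpow_const (p := 1 / q) (Or.inr (by positivity))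
    rwa [Real.zero_rpow (by positivity)] at this
  obtain ⟨n, hn1, hn2, hn⟩ := ((hlim1.eventually (eventually_le_nhds
    (by positivity : 0 < ε / 4))).and ((hlim2.eventually (eventually_le_nhds
    (by positivity : 0 < ε / 4))).and (Filter.eventually_ge_atTop 1))).exists
  obtain ⟨ρ, s, hs, hρ, hmom, hvar⟩ := exists_weights_vanishing_moments hn hη
  set N : ℕ := R * n with hN
  have hN0 : 0 < N := Nat.mul_pos hR hn
  have hN' : (0 : ℝ) < N := by exact_mod_cast hN0
  have hNcast : (N : ℝ) = R * n := by rw [hN]; push_cast; ring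
  set θs := Finset.univ.erase (fun _ : Fin N => (2 : Fin 5)) with hθs
  set a : (Fin N → Fin 5) → ℝ := fun θ =>
    (∑ i ∈ Finset.range (n + 1), ρ i * s i ^ (∑ j, absDigit (θ j))) * ∏ j, digitWeight (θ j)
    with ha
  obtain ⟨M, -, hM⟩ := exists_norm_coeffLp_sum_le p θs (digitFreq_injective N).injOn
    (fun θ => (a θ : ℂ)) (fun θ => ∏ j, digitPow v (θ j))
    (fun θ => (Finset.norm_prod_le _ _).trans
      (Finset.prod_le_one (fun _ _ => norm_nonneg _) fun j _ => norm_digitPow_le hv1 _))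
    (by positivity : 0 < ε / 4)
  set f := averagedProduct n N ρ s v M with hf
  have hsum : ∑ θ ∈ θs, ‖(a θ : ℂ)‖ ^ q ≤ Real.exp (-(n : ℝ)) := by
    have h := sum_rpow_moment_le (N := N) hη (by linarith : (1 : ℝ) ≤ q) hL1 hs hmom hvar
    simp only [Complex.norm_real, Real.norm_eq_abs]
    refine h.trans (le_of_eq ?_)
    have h1 : Real.exp (L * η ^ q) ^ N = Real.exp 1 ^ n := by
      rw [← Real.exp_nat_mul, ← Real.exp_nat_mul, hNcast, mul_one]
      congr 1
      calc (R : ℝ) * n * (L * η ^ q) = (L * η ^ q * R) * n := by ring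
        _ = n := by rw [hLR, one_mul]
    have h8 : (0 : ℝ) < 8 ^ q := by positivity
    have he := Real.exp_pos 1
    rw [h1, Real.exp_neg, ← mul_pow, ← mul_pow, ← Real.exp_one_pow, ← inv_pow, hL]
    congr 1
    field_simp
  have hf1 : ‖coeffLp p (f - 1)‖ ≤ ε / 4 + ε / 4 := by
    rw [hf, averagedProduct_sub_one hρ]
    refine hM.trans ?_
    gcongr
    refine le_trans ?_ hn2
    gcongr
  -- the cutoff
  set w : C(Torus, ℂ) := ((N : ℂ)⁻¹) • ∑ j : Fin N, v * fourier (M * 5 ^ (j : ℕ)) with hw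
  have hwt : w ∈ Test := Submodule.smul_mem _ _ (Submodule.sum_mem _ fun j _ =>
    mul_mem_test hv (fourier_mem_test _))
  have hwre : ∀ t, (w t).re
      = (∑ j : Fin N, ((v * fourier (M * 5 ^ (j : ℕ)) : C(Torus, ℂ)) t).re) / N := by
    intro t
    rw [hw, ContinuousMap.smul_apply, ContinuousMap.sum_apply, smul_eq_mul,
      ← Complex.ofReal_natCast, ← Complex.ofReal_inv, Complex.re_ofReal_mul, Complex.re_sum,
      inv_mul_eq_div]
  obtain ⟨ψ, hψ, hψ1, hψ2, hψ3⟩ := exists_cutoff hwt (by positivity : 0 < η / 20)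
  refine ⟨f * ψ, mul_mem_test (averagedProduct_mem_test hv M) hψ, N, fun j => M * 5 ^ (j : ℕ),
    hN0, ?_, ?_⟩
  · have hcut : ‖f * (1 - ψ)‖ ≤ Real.exp (-(n : ℝ)) := by
      rw [ContinuousMap.norm_le _ (Real.exp_pos _).le]
      intro t
      rcases le_or_gt (η / 20) (w t).re with h | h
      · rw [ContinuousMap.mul_apply, ContinuousMap.sub_apply, hψ3 t h]
        simpa using (Real.exp_pos _).le
      · rw [ContinuousMap.mul_apply, norm_mul, ContinuousMap.sub_apply, ContinuousMap.one_apply]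
        rw [hwre, div_lt_iff₀ hN'] at h
        calc ‖f t‖ * ‖1 - ψ t‖ ≤ ‖f t‖ * 1 := by gcongr; exact hψ1 t
          _ = ‖f t‖ := mul_one _
          _ ≤ 8 ^ n * Real.exp (-(η ^ 2 / 40 * N)) :=
            norm_averagedProduct_apply_le hη hη' hs hvar hv1 M h.le
          -- The bound 160 ≤ η² R gives η² N/40 ≥ 4n, which beats 8^n ≤ e^(3n).
          _ ≤ Real.exp 3 ^ n * Real.exp (-(4 * n)) := by
            have h8 : (8 : ℝ) ≤ Real.exp 3 := by
              have h1 : Real.exp 3 = Real.exp 1 ^ 3 := by rw [← Real.exp_nat_mul]; norm_num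
              have h2 := Real.add_one_le_exp (1 : ℝ)
              have h3 : (2 : ℝ) ^ 3 ≤ Real.exp 1 ^ 3 := by gcongr; linarith
              rw [h1]; linarith
            have hn0 : (0 : ℝ) ≤ n := by positivity
            have h4 : 4 * (n : ℝ) ≤ η ^ 2 / 40 * N := by
              rw [hNcast]
              nlinarith [mul_le_mul_of_nonneg_right hηR hn0]
            exact mul_le_mul (pow_le_pow_left₀ (by norm_num) h8 n)
              (Real.exp_le_exp.mpr (neg_le_neg h4)) (Real.exp_pos _).le (by positivity)
          _ = Real.exp (-(n : ℝ)) := by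
            rw [← Real.exp_nat_mul, ← Real.exp_add]
            congr 1
            ring
    have heq : f * ψ - 1 = (f - 1) - f * (1 - ψ) := by ring
    rw [heq, map_sub]
    have h1 := norm_sub_le (coeffLp p (f - 1)) (coeffLp p (f * (1 - ψ)))
    have h2 := norm_coeffLp_le p (f * (1 - ψ))
    linarith
  · intro t ht
    have h := hψ2 t (fun h0 => ht (by rw [ContinuousMap.mul_apply, h0, mul_zero]))
    rw [hwre, le_div_iff₀ hN'] at h
    calc η / 40 * N = η / 20 / 2 * N := by ring
      _ ≤ _ := h

/-! ### From correlation to the Helson property -/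

/-- A bounded operator whose range approximates up to a factor `κ < 1` is onto. -/
theorem surjective_of_approx {E F : Type*} [NormedAddCommGroup E] [NormedSpace ℝ E]
    [CompleteSpace E] [NormedAddCommGroup F] [NormedSpace ℝ F] (T : E →L[ℝ] F) {C κ : ℝ}
    (hκ0 : 0 ≤ κ) (hκ : κ < 1)
    (h : ∀ y, ∃ x, ‖x‖ ≤ C * ‖y‖ ∧ ‖y - T x‖ ≤ κ * ‖y‖) : Function.Surjective T := by
  intro y
  choose x hx1 hx2 using h
  let r : ℕ → F := fun k => Nat.rec y (fun _ z => z - T (x z)) k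
  have hr0 : r 0 = y := rfl
  have hr : ∀ k, r (k + 1) = r k - T (x (r k)) := fun k => rfl
  have hrn : ∀ k, ‖r k‖ ≤ κ ^ k * ‖y‖ := by
    intro k
    induction k with
    | zero => simp [hr0]
    | succ k ih =>
      rw [hr, pow_succ']
      calc _ ≤ κ * ‖r k‖ := hx2 _
        _ ≤ κ * (κ ^ k * ‖y‖) := by gcongr
        _ = _ := by ring
  have hC : ∀ k, ‖x (r k)‖ ≤ κ ^ k * (|C| * ‖y‖) := fun k => by
    calc _ ≤ C * ‖r k‖ := hx1 _
      _ ≤ |C| * (κ ^ k * ‖y‖) := by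
        gcongr
        · exact le_abs_self C
        · exact hrn k
      _ = _ := by ring
  have hsum : Summable fun k => x (r k) :=
    Summable.of_norm_bounded ((summable_geometric_of_lt_one hκ0 hκ).mul_right _) hC
  refine ⟨∑' k, x (r k), ?_⟩
  have h1 := (T.hasSum hsum.hasSum).tendsto_sum_nat
  have h2 : ∀ n, ∑ k ∈ Finset.range n, T (x (r k)) = y - r n := by
    intro n
    induction n with
    | zero => simp [hr0]
    | succ n ih => rw [Finset.sum_range_succ, ih, hr]; abel
  simp only [h2] at h1
  have h3 : Filter.Tendsto r Filter.atTop (nhds 0) := by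
    refine squeeze_zero_norm hrn ?_
    simpa using (tendsto_pow_atTop_nhds_zero_of_lt_one hκ0 hκ).mul_const ‖y‖
  have h4 : Filter.Tendsto (fun n => y - r n) Filter.atTop (nhds (y - 0)) := h3.const_sub y
  rw [sub_zero] at h4
  exact tendsto_nhds_unique h1 h4

theorem hasSum_norm_seq (a : SeqLp 1) : HasSum (fun n => ‖a n‖) ‖a‖ := by
  simpa using lp.hasSum_norm (p := 1) (by norm_num) a

theorem norm_smul_fourier (z : ℂ) (n : ℤ) : ‖z • (fourier n : C(Torus, ℂ))‖ = ‖z‖ := by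
  rw [norm_smul, fourier_norm, mul_one]

theorem summable_smul_fourier (a : SeqLp 1) :
    Summable fun n => a n • (fourier n : C(Torus, ℂ)) := by
  refine Summable.of_norm ?_
  simpa only [norm_smul_fourier] using (hasSum_norm_seq a).summable

/-- The function with a given absolutely summable sequence of Fourier coefficients. -/
noncomputable def synth : SeqLp 1 →L[ℂ] C(Torus, ℂ) :=
  LinearMap.mkContinuous
    { toFun := fun a => ∑' n, a n • (fourier n : C(Torus, ℂ))
      map_add' := fun a b => by
        rw [← (summable_smul_fourier a).tsum_add (summable_smul_fourier b)]
        exact tsum_congr fun n => add_smul (a n) (b n) _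
      map_smul' := fun c a => by
        rw [RingHom.id_apply, ← (summable_smul_fourier a).tsum_const_smul]
        exact tsum_congr fun n => mul_smul c (a n) _ } 1
    fun a => by
      rw [one_mul]
      exact tsum_of_norm_bounded (hasSum_norm_seq a) fun _ => (norm_smul_fourier _ _).le

theorem hasSum_synth (a : SeqLp 1) :
    HasSum (fun n => a n • (fourier n : C(Torus, ℂ))) (synth a) :=
  (summable_smul_fourier a).hasSum

theorem norm_synth_le (a : SeqLp 1) : ‖synth a‖ ≤ ‖a‖ :=
  tsum_of_norm_bounded (hasSum_norm_seq a) fun _ => (norm_smul_fourier _ _).le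

theorem fourierCoeff_synth (a : SeqLp 1) (n : ℤ) :
    fourierCoeff (synth a : Torus → ℂ) n = a n := by
  have h := (coeffCLM n).hasSum (hasSum_synth a)
  refine h.unique ?_
  convert! hasSum_ite_eq n (a n) using 2 with k
  simp only [map_smul, coeffCLM_apply, fourierCoeff_fourier, smul_eq_mul]
  by_cases hk : k = n
  · subst hk; simp
  · simp [hk]

theorem memWiener_synth (a : SeqLp 1) : MemWiener (synth a) := by
  simp only [MemWiener, fourierCoeff_synth]
  exact (hasSum_norm_seq a).summable

theorem synth_single (n : ℤ) (z : ℂ) : synth (lp.single 1 n z) = z • fourier n := by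
  refine (hasSum_synth _).unique ?_
  convert! hasSum_ite_eq n (z • (fourier n : C(Torus, ℂ))) using 2 with k
  by_cases hk : k = n
  · subst hk; simp
  · simp [hk, lp.single_apply]

theorem memWiener_add {f g : C(Torus, ℂ)} (hf : MemWiener f) (hg : MemWiener g) :
    MemWiener (f + g) :=
  Summable.of_nonneg_of_le (fun _ => norm_nonneg _)
    (fun n => by rw [fourierCoeff_coe_add]; exact norm_add_le _ _) (hf.add hg)

theorem memWiener_smul {f : C(Torus, ℂ)} (c : ℂ) (hf : MemWiener f) : MemWiener (c • f) := by
  have h : ∀ n, fourierCoeff ((c • f : C(Torus, ℂ)) : Torus → ℂ) n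
      = c • fourierCoeff (f : Torus → ℂ) n := fun n => fourierCoeff.const_smul _ c n
  simp only [MemWiener, h, norm_smul]
  exact hf.mul_left _

theorem fourierCoeff_star (f : C(Torus, ℂ)) (n : ℤ) :
    fourierCoeff ((star f : C(Torus, ℂ)) : Torus → ℂ) n
      = star (fourierCoeff (f : Torus → ℂ) (-n)) := by
  simp only [fourierCoeff]
  rw [Complex.star_def, ← integral_conj]
  refine integral_congr_ae (Filter.Eventually.of_forall fun t => ?_)
  simp only [smul_eq_mul, map_mul, neg_neg]
  rw [← fourier_neg]
  rfl

theorem memWiener_star {f : C(Torus, ℂ)} (hf : MemWiener f) : MemWiener (star f) := by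
  simp only [MemWiener, fourierCoeff_star, norm_star]
  exact (Equiv.neg ℤ).summable_iff.mpr hf

/-- Functions `exp (-i α)` with `α` real and continuous are uniform limits of smooth unimodular
functions. -/
theorem exists_unimodular_test_near (α : C(Torus, ℝ)) {δ : ℝ} (hδ : 0 < δ) :
    ∃ v ∈ Test, (∀ t, ‖v t‖ = 1) ∧ ∀ t, |(v t).re - Real.cos (α t)| ≤ δ := by
  let A : C(Torus, ℂ) := ⟨fun t => (α t : ℂ), by fun_prop⟩
  have hA : A ∈ (Submodule.span ℂ (Set.range (fourier (T := 2 * Real.pi)))).topologicalClosure := by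
    rw [span_fourier_closure_eq_top]; trivial
  obtain ⟨P, hP, hPA⟩ := Metric.mem_closure_iff.mp hA δ hδ
  have hPt : P ∈ Test := by
    refine (Submodule.span_le.mpr ?_) hP
    rintro _ ⟨n, rfl⟩
    exact fourier_mem_test n
  -- Taking the real part of the trigonometric polynomial keeps the exponential unimodular; the
  -- cosine is 1-Lipschitz.
  refine ⟨⟨fun t => Complex.exp (((P t).re : ℂ) * Complex.I), by fun_prop⟩, ?_, ?_, ?_⟩
  · refine mem_test_of_contDiff ?_
    have h1 : ContDiff ℝ ∞ fun x : ℝ => (((periodize P x).re : ℝ) : ℂ) :=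
      Complex.ofRealCLM.contDiff.comp (Complex.reCLM.contDiff.comp (contDiff_periodize hPt))
    exact (h1.mul contDiff_const).cexp
  · intro t
    exact Complex.norm_exp_ofReal_mul_I _
  · intro t
    simp only [ContinuousMap.coe_mk, Complex.exp_ofReal_mul_I_re]
    refine (Real.abs_cos_sub_cos_le _ _).trans ?_
    have h1 : (P t).re - α t = (P t - A t).re := by simp [A]
    rw [h1]
    refine (Complex.abs_re_le_norm _).trans ?_
    rw [← dist_eq_norm, dist_comm]
    exact (ContinuousMap.dist_apply_le_dist t).trans hPA.le

/-- Expanding the square, |v - c h̄|² ≤ 1 - 2c² + c² = 1 - c² ≤ (1 - c²/2)². Only the real part is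
kept, where h and h̄ agree. -/
theorem abs_re_sub_le_of_correlation {v h : ℂ} {c : ℝ} (hc : 0 < c) (hc1 : c ≤ 1) (hv : ‖v‖ = 1)
    (hh : ‖h‖ ≤ 1) (hvh : c ≤ (v * h).re) : |v.re - c * h.re| ≤ 1 - c ^ 2 / 2 := by
  have hv2 : v.re ^ 2 + v.im ^ 2 = 1 := by
    have := Complex.sq_norm v
    rw [hv, Complex.normSq_apply] at this
    nlinarith
  have hh2 : h.re ^ 2 + h.im ^ 2 ≤ 1 := by
    have := Complex.sq_norm h
    rw [Complex.normSq_apply] at this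
    nlinarith [norm_nonneg h]
  rw [Complex.mul_re] at hvh
  refine abs_le_of_sq_le_sq ?_ (by nlinarith)
  have h1 : (v.re - c * h.re) ^ 2 ≤ (v.re - c * h.re) ^ 2 + (v.im + c * h.im) ^ 2 := by
    linarith [sq_nonneg (v.im + c * h.im)]
  have h2 : (v.re - c * h.re) ^ 2 + (v.im + c * h.im) ^ 2
      = (v.re ^ 2 + v.im ^ 2) - 2 * c * (v.re * h.re - v.im * h.im)
        + c ^ 2 * (h.re ^ 2 + h.im ^ 2) := by ring
  have h3 : c ^ 2 * (h.re ^ 2 + h.im ^ 2) ≤ c ^ 2 * 1 := by gcongr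
  have h4 : 2 * c * c ≤ 2 * c * (v.re * h.re - v.im * h.im) := by gcongr
  nlinarith [sq_nonneg (c ^ 2)]

/-- A closed set is Helson if a uniformly dense family of smooth unimodular functions correlates
on it with averages of exponentials. -/
theorem isHelson_of_correlation {K : Set Torus} (hK : IsClosed K) {c : ℝ} (hc : 0 < c)
    (hc1 : c ≤ 1)
    (h : ∀ v ∈ Test, (∀ t, ‖v t‖ = 1) → ∀ δ : ℝ, 0 < δ → ∃ v' : C(Torus, ℂ),
      (∀ t, ‖v' t‖ = 1) ∧ ‖v' - v‖ ≤ δ ∧ ∃ (N : ℕ) (ν : Fin N → ℤ), 0 < N ∧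
        ∀ t ∈ K, c * N ≤ ∑ j, ((v' * fourier (ν j) : C(Torus, ℂ)) t).re) :
    IsHelson K := by
  have : CompactSpace K := isCompact_iff_compactSpace.mp hK.isCompact
  let T : SeqLp 1 →L[ℝ] C(K, ℝ) := LinearMap.mkContinuous
    { toFun := fun a => ⟨fun x => (synth a x).re, by fun_prop⟩
      map_add' := fun a b => by ext x; simp
      map_smul' := fun r a => by
        ext x
        have h1 : synth (r • a) = (r : ℂ) • synth a := by
          rw [← map_smul]; congr 1
        simp [h1] } 1
    fun a => by
      rw [one_mul, ContinuousMap.norm_le _ (norm_nonneg _)]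
      intro x
      exact ((Complex.abs_re_le_norm _).trans ((synth a).norm_coe_le_norm _)).trans
        (norm_synth_le a)
  have hT : ∀ a x, T a x = (synth a x).re := fun a x => rfl
  -- Write u = cos α with α extended to the circle by Tietze. Passing from cos α to Re v and from v
  -- to v' costs c²/8 each, out of the margin c²/2.
  have happ : ∀ u : C(K, ℝ), ‖u‖ ≤ 1 → ∃ a, ‖a‖ ≤ 1 ∧ ‖u - T a‖ ≤ 1 - c ^ 2 / 4 := by
    intro u hu
    have hδ : 0 < c ^ 2 / 8 := by positivity
    obtain ⟨α, hα⟩ := ContinuousMap.exists_restrict_eq hK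
      (⟨fun x => Real.arccos (u x), by fun_prop⟩ : C(K, ℝ))
    have hα' : ∀ x : K, Real.cos (α x) = u x := by
      intro x
      have h1 : α x = Real.arccos (u x) := congrArg (fun f : C(K, ℝ) => f x) hα
      have h2 := abs_le.mp ((u.norm_coe_le_norm x).trans hu)
      rw [h1, Real.cos_arccos h2.1 h2.2]
    obtain ⟨v, hv, hv1, hvα⟩ := exists_unimodular_test_near α hδ
    obtain ⟨v', hv'1, hvv', N, ν, hN, hcor⟩ := h v hv hv1 _ hδ
    have hN' : (0 : ℝ) < N := by exact_mod_cast hN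
    refine ⟨∑ j, lp.single 1 (ν j) ((c / N : ℝ) : ℂ), ?_, ?_⟩
    · refine (norm_sum_le _ _).trans ?_
      simp only [lp.norm_single zero_lt_one, Complex.norm_real, Real.norm_eq_abs]
      rw [Finset.sum_const, Finset.card_univ, Fintype.card_fin, nsmul_eq_mul,
        abs_of_pos (by positivity)]
      calc (N : ℝ) * (c / N) = c := by field_simp
        _ ≤ 1 := hc1
    · rw [ContinuousMap.norm_le _ (by nlinarith)]
      intro x
      set H : ℂ := (N : ℂ)⁻¹ * ∑ j, fourier (ν j) (x : Torus) with hH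
      have hH1 : ‖H‖ ≤ 1 := by
        rw [hH, norm_mul, norm_inv, Complex.norm_natCast, inv_mul_le_iff₀ hN', mul_one]
        refine (norm_sum_le _ _).trans ?_
        simp only [fourier_apply, Circle.norm_coe]
        simp
      have hHc : c ≤ (v' x * H).re := by
        have h1 := hcor x x.2
        have h2 : v' x * H = ((N : ℝ)⁻¹ : ℝ) * ∑ j, (v' * fourier (ν j) : C(Torus, ℂ)) x := by
          rw [hH]
          simp only [ContinuousMap.mul_apply, ← Finset.mul_sum]
          push_cast
          ring
        rw [h2, Complex.re_ofReal_mul, Complex.re_sum, inv_mul_eq_div, le_div_iff₀ hN']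
        exact h1
      have hTx : T (∑ j, lp.single 1 (ν j) ((c / N : ℝ) : ℂ)) x = c * H.re := by
        rw [hT, map_sum, ContinuousMap.sum_apply]
        simp only [synth_single, ContinuousMap.smul_apply, smul_eq_mul]
        rw [← Finset.mul_sum, Complex.re_ofReal_mul, hH, ← Complex.ofReal_natCast,
          ← Complex.ofReal_inv, Complex.re_ofReal_mul]
        ring
      have h3 := abs_re_sub_le_of_correlation hc hc1 (hv'1 x) hH1 hHc
      have h4 : |(v' x).re - (v x).re| ≤ c ^ 2 / 8 := by
        rw [← Complex.sub_re]
        exact ((Complex.abs_re_le_norm _).trans ((v' - v).norm_coe_le_norm x)).trans hvv'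
      have h5 := hvα x
      rw [hα'] at h5
      rw [ContinuousMap.sub_apply, hTx, Real.norm_eq_abs]
      rw [abs_le] at h3 h4 h5 ⊢
      constructor <;> linarith
  have hsurj : Function.Surjective T := by
    refine surjective_of_approx T (C := 1) (κ := 1 - c ^ 2 / 4) (by nlinarith) (by nlinarith)
      fun y => ?_
    rcases eq_or_ne y 0 with rfl | hy
    · exact ⟨0, by simp⟩
    have hy0 : 0 < ‖y‖ := norm_pos_iff.mpr hy
    obtain ⟨a, ha1, ha2⟩ := happ (‖y‖⁻¹ • y) (by
      rw [norm_smul, norm_inv, norm_norm, inv_mul_cancel₀ hy0.ne'])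
    refine ⟨‖y‖ • a, ?_, ?_⟩
    · rw [norm_smul, norm_norm, one_mul]
      exact mul_le_of_le_one_right hy0.le ha1
    · have h1 : y - T (‖y‖ • a) = ‖y‖ • (‖y‖⁻¹ • y - T a) := by
        rw [smul_sub, smul_smul, mul_inv_cancel₀ hy0.ne', one_smul, map_smul]
      rw [h1, norm_smul, norm_norm, mul_comm]
      gcongr
  refine ⟨hK.isCompact, fun g => ?_⟩
  obtain ⟨a, ha⟩ := hsurj ⟨fun x => (g x).re, by fun_prop⟩
  obtain ⟨b, hb⟩ := hsurj ⟨fun x => (g x).im, by fun_prop⟩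
  have ha' : ∀ x : K, (synth a x).re = (g x).re := fun x => congrArg (fun f : C(K, ℝ) => f x) ha
  have hb' : ∀ x : K, (synth b x).re = (g x).im := fun x => congrArg (fun f : C(K, ℝ) => f x) hb
  have hW : ∀ a, MemWiener (synth a + star (synth a)) := fun a =>
    memWiener_add (memWiener_synth a) (memWiener_star (memWiener_synth a))
  -- `T` sees only real parts. Since the Wiener algebra is closed under conjugation, the two real
  -- parts can be recombined into g.
  refine ⟨(1 / 2 : ℂ) • (synth a + star (synth a)) +
    (Complex.I / 2) • (synth b + star (synth b)),
    memWiener_add (memWiener_smul _ (hW a)) (memWiener_smul _ (hW b)), fun x => ?_⟩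
  have hre : ∀ z : ℂ, z + star z = ((2 * z.re : ℝ) : ℂ) := fun z => Complex.add_conj z
  simp only [ContinuousMap.add_apply, ContinuousMap.smul_apply, ContinuousMap.star_apply, hre,
    ha', hb', smul_eq_mul]
  conv_rhs => rw [← Complex.re_add_im (g x)]
  push_cast
  ring

/-! ### Distributions with coefficients in `ℓ^p` -/

theorem memWiener_test (φ : Test) : MemWiener (φ : C(Torus, ℂ)) := memWiener_of_mem_test φ.2

theorem hasSum_norm_fourierCoeff_neg (φ : Test) :
    HasSum (fun n => ‖fourierCoeff ((φ : C(Torus, ℂ)) : Torus → ℂ) (-n)‖)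
      (∑' n, ‖fourierCoeff ((φ : C(Torus, ℂ)) : Torus → ℂ) n‖) :=
  (Equiv.neg ℤ).hasSum_iff.mpr (memWiener_test φ).hasSum

theorem norm_mul_fourierCoeff_neg_le (p : ℝ≥0∞) [Fact (1 ≤ p)] (S : SeqLp p) (φ : Test) (n : ℤ) :
    ‖S n * fourierCoeff ((φ : C(Torus, ℂ)) : Torus → ℂ) (-n)‖
      ≤ ‖S‖ * ‖fourierCoeff ((φ : C(Torus, ℂ)) : Torus → ℂ) (-n)‖ := by
  rw [norm_mul]
  gcongr
  exact lp.norm_apply_le_norm (zero_lt_one.trans_le (Fact.out : 1 ≤ p)).ne' S n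

theorem summable_mul_fourierCoeff_neg (p : ℝ≥0∞) [Fact (1 ≤ p)] (S : SeqLp p) (φ : Test) :
    Summable fun n => S n * fourierCoeff ((φ : C(Torus, ℂ)) : Torus → ℂ) (-n) :=
  Summable.of_norm_bounded ((hasSum_norm_fourierCoeff_neg φ).summable.mul_left _)
    (norm_mul_fourierCoeff_neg_le p S φ)

theorem norm_tsum_mul_fourierCoeff_neg_le (p : ℝ≥0∞) [Fact (1 ≤ p)] (S : SeqLp p) (φ : Test) :
    ‖∑' n, S n * fourierCoeff ((φ : C(Torus, ℂ)) : Torus → ℂ) (-n)‖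
      ≤ ‖S‖ * ∑' n, ‖fourierCoeff ((φ : C(Torus, ℂ)) : Torus → ℂ) n‖ :=
  tsum_of_norm_bounded ((hasSum_norm_fourierCoeff_neg φ).mul_left _)
    (norm_mul_fourierCoeff_neg_le p S φ)

/-- The distribution with a given sequence of Fourier coefficients in `ℓ^p`. -/
noncomputable def distrOfSeq (p : ℝ≥0∞) [Fact (1 ≤ p)] (S : SeqLp p) : Distr where
  toFun :=
    { toFun := fun φ => ∑' n, S n * fourierCoeff ((φ : C(Torus, ℂ)) : Torus → ℂ) (-n)
      map_add' := fun φ ψ => by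
        rw [← (summable_mul_fourierCoeff_neg p S φ).tsum_add (summable_mul_fourierCoeff_neg p S ψ)]
        refine tsum_congr fun n => ?_
        rw [← mul_add, ← fourierCoeff_coe_add]
        rfl
      map_smul' := fun c φ => by
        rw [RingHom.id_apply, ← (summable_mul_fourierCoeff_neg p S φ).tsum_const_smul]
        refine tsum_congr fun n => ?_
        have h : fourierCoeff (((c • φ : Test) : C(Torus, ℂ)) : Torus → ℂ) (-n)
            = c • fourierCoeff ((φ : C(Torus, ℂ)) : Torus → ℂ) (-n) :=
          fourierCoeff.const_smul _ c _
        rw [h, mul_smul_comm] }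
  bounded' := by
    refine ⟨2, ‖S‖ * ∑' n, decayWeight n, fun φ M hM => ?_⟩
    refine (norm_tsum_mul_fourierCoeff_neg_le p S φ).trans ?_
    rw [mul_assoc]
    gcongr
    rw [mul_comm _ M, ← tsum_mul_left]
    refine (memWiener_test φ).tsum_le_tsum (fun n => ?_) (summable_decayWeight.mul_left M)
    exact norm_fourierCoeff_le_decayWeight φ.2
      (fun x => by simpa using hM 0 (by norm_num) x) (hM 2 le_rfl) n

theorem distrOfSeq_apply (p : ℝ≥0∞) [Fact (1 ≤ p)] (S : SeqLp p) (φ : Test) :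
    (distrOfSeq p S).toFun φ
      = ∑' n, S n * fourierCoeff ((φ : C(Torus, ℂ)) : Torus → ℂ) (-n) := rfl

theorem coeff_distrOfSeq (p : ℝ≥0∞) [Fact (1 ≤ p)] (S : SeqLp p) :
    (distrOfSeq p S).coeff = S := by
  ext n
  rw [Distr.coeff, distrOfSeq_apply, tsum_eq_single n]
  · simp [expTest, fourierCoeff_fourier]
  · intro k hk
    have : -k ≠ -n := fun h => hk (neg_injective h)
    simp [expTest, fourierCoeff_fourier, this]

/-- A smooth `P` acts by integration against it, so the pairing vanishes as soon as P φ = 0. This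
locates the support of the limit. -/
theorem distrOfSeq_coeffLp_apply (p : ℝ≥0∞) [Fact (1 ≤ p)] [Fact (2 ≤ p)] [Fact (p ≠ ⊤)]
    {P : C(Torus, ℂ)} (hP : P ∈ Test) (φ : Test) :
    (distrOfSeq p (coeffLp p P)).toFun φ
      = fourierCoeff ((P * φ : C(Torus, ℂ)) : Torus → ℂ) 0 := by
  have h1 : HasSum (fun n => fourierCoeff (P : Torus → ℂ) n • (fourier n : C(Torus, ℂ))) P :=
    hasSum_fourier_series_of_summable (memWiener_of_mem_test hP).of_norm
  have h2 := (coeffCLM 0).hasSum (h1.mul_right (φ : C(Torus, ℂ)))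
  rw [distrOfSeq_apply, ← coeffCLM_apply, ← h2.tsum_eq]
  refine tsum_congr fun n => ?_
  rw [smul_mul_assoc, map_smul, coeffCLM_apply, fourierCoeff_fourier_mul, zero_sub]
  rfl

theorem tendsto_distrOfSeq_apply (p : ℝ≥0∞) [Fact (1 ≤ p)] {u : ℕ → SeqLp p} {S : SeqLp p}
    (h : Filter.Tendsto u Filter.atTop (nhds S)) (φ : Test) :
    Filter.Tendsto (fun k => (distrOfSeq p (u k)).toFun φ) Filter.atTop
      (nhds ((distrOfSeq p S).toFun φ)) := by
  rw [tendsto_iff_norm_sub_tendsto_zero] at h ⊢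
  refine squeeze_zero (fun _ => norm_nonneg _) (fun k => ?_)
    (by simpa using h.mul_const (∑' n, ‖fourierCoeff ((φ : C(Torus, ℂ)) : Torus → ℂ) n‖))
  have h1 := norm_tsum_mul_fourierCoeff_neg_le p (u k - S) φ
  rw [distrOfSeq_apply, distrOfSeq_apply, ← (summable_mul_fourierCoeff_neg p (u k) φ).tsum_sub
    (summable_mul_fourierCoeff_neg p S φ)]
  simpa [sub_mul] using h1

/-! ### The infinite product and the conclusion -/

/-- An infinite product of smooth multipliers, with limit in `ℓ^p` near the constant `1`. -/
theorem exists_seq_products (p : ℝ≥0∞) [Fact (1 ≤ p)] [Fact (2 ≤ p)] [Fact (p ≠ ⊤)]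
    {Q : ℕ → C(Torus, ℂ) → Prop}
    (hQ : ∀ k, ∀ ε : ℝ, 0 < ε → ∃ F ∈ Test, ‖coeffLp p (F - 1)‖ < ε ∧ Q k F) :
    ∃ P F : ℕ → C(Torus, ℂ), (∀ k, P k ∈ Test) ∧ P 0 = 1 ∧ (∀ k, P (k + 1) = P k * F k) ∧
      (∀ k, Q k (F k)) ∧ ∀ k, ‖coeffLp p (P (k + 1) - P k)‖ ≤ 1 / 4 * (1 / 2) ^ k := by
  have hstep : ∀ k (P : Test), ∃ F ∈ Test, Q k F ∧
      ‖coeffLp p ((P : C(Torus, ℂ)) * F - P)‖ ≤ 1 / 4 * (1 / 2) ^ k := by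
    intro k P
    set A := ∑' n, ‖fourierCoeff ((P : C(Torus, ℂ)) : Torus → ℂ) n‖ with hA
    have hA0 : 0 ≤ A := tsum_nonneg fun _ => norm_nonneg _
    -- The tolerance for the next factor is chosen after the Wiener norm A of the current product is
    -- known; A + 1 keeps the denominator positive.
    have hε : (0 : ℝ) < 1 / 4 * (1 / 2) ^ k / (A + 1) := by positivity
    obtain ⟨F, hF, hF1, hF2⟩ := hQ k _ hε
    refine ⟨F, hF, hF2, ?_⟩
    have h1 : (P : C(Torus, ℂ)) * F - P = P * (F - 1) := by ring
    rw [h1]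
    refine (norm_coeffLp_mul_le p (memWiener_test P) _).trans ?_
    calc A * ‖coeffLp p (F - 1)‖ ≤ (A + 1) * (1 / 4 * (1 / 2) ^ k / (A + 1)) := by
          gcongr; linarith
      _ = _ := by field_simp
  choose F hF hFQ hFn using hstep
  let next : ℕ → Test → Test := fun k R => ⟨R * F k R, mul_mem_test R.2 (hF k R)⟩
  obtain ⟨P, hP0, hPs⟩ : ∃ P : ℕ → Test, P 0 = ⟨1, one_mem_test⟩ ∧ ∀ k, P (k + 1) = next k (P k) :=
    ⟨fun k => Nat.rec ⟨1, one_mem_test⟩ next k, rfl, fun _ => rfl⟩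
  have hPs' : ∀ k, (P (k + 1) : C(Torus, ℂ)) = P k * F k (P k) := fun k => by rw [hPs]
  refine ⟨fun k => P k, fun k => F k (P k), fun k => (P k).2, ?_, hPs',
    fun k => hFQ k (P k), fun k => ?_⟩
  · beta_reduce
    rw [hP0]
  · beta_reduce
    rw [hPs']
    exact hFn k (P k)

/-- Smooth unimodular functions. -/
abbrev UnimodularTest : Type := {v : C(Torus, ℂ) // v ∈ Test ∧ ∀ t, ‖v t‖ = 1}

theorem exists_helson_distr (p : ℝ≥0∞) [Fact (1 ≤ p)] [Fact (2 ≤ p)] [Fact (p ≠ ⊤)]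
    (hp : 2 < p.toReal) :
    ∃ (K : Set Torus) (S : SeqLp p), IsHelson K ∧ (distrOfSeq p S).toFun ≠ 0 ∧
      (distrOfSeq p S).support ⊆ K := by
  obtain ⟨c, hc, hc1, hmul⟩ := exists_multiplier p hp
  have : Nonempty UnimodularTest := ⟨⟨1, one_mem_test, fun t => by simp⟩⟩
  let d : ℕ → UnimodularTest := TopologicalSpace.denseSeq UnimodularTest
  obtain ⟨P, F, hP, hP0, hPF, hF, hPn⟩ := exists_seq_products p
    (Q := fun k F => ∃ (N : ℕ) (ν : Fin N → ℤ), 0 < N ∧ ∀ t, F t ≠ 0 →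
      c * N ≤ ∑ j, (((d k : C(Torus, ℂ)) * fourier (ν j) : C(Torus, ℂ)) t).re)
    (fun k ε hε => by
      obtain ⟨F, hF, N, ν, hN, hF1, hF2⟩ := hmul (d k) (d k).2.1 (d k).2.2 ε hε
      exact ⟨F, hF, hF1, N, ν, hN, hF2⟩)
  choose N ν hN hcor using hF
  have hdist : ∀ k, dist (coeffLp p (P k)) (coeffLp p (P (k + 1))) ≤ 1 / 4 * (1 / 2) ^ k := by
    intro k
    rw [dist_comm, dist_eq_norm, ← map_sub]
    exact hPn k
  obtain ⟨S, hS⟩ := cauchySeq_tendsto_of_complete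
    (cauchySeq_of_le_geometric (1 / 2) (1 / 4) (by norm_num) hdist)
  -- The increments sum to at most (1/4)/(1 - 1/2) = 1/2, while the initial product 1 has zeroth
  -- coefficient 1.
  have hS0 : S 0 ≠ 0 := by
    have h1 := dist_le_of_le_geometric_of_tendsto₀ (1 / 2) (1 / 4) (by norm_num) hdist hS
    have h2 : ‖coeffLp p (P 0) 0 - S 0‖ ≤ 1 / 2 := by
      rw [dist_eq_norm] at h1
      have h3 := lp.norm_apply_le_norm (zero_lt_one.trans_le (Fact.out : 1 ≤ p)).ne'
        (coeffLp p (P 0) - S) 0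
      refine h3.trans (h1.trans (by norm_num))
    intro h0
    rw [h0, hP0, coeffLp_apply, ← fourier_zero_eq_one, fourierCoeff_fourier] at h2
    norm_num at h2
  let G : ℕ → Torus → ℝ := fun k t =>
    ∑ j, (((d k : C(Torus, ℂ)) * fourier (ν k j) : C(Torus, ℂ)) t).re
  have hG : ∀ k, Continuous (G k) := fun k => by fun_prop
  let K : Set Torus := {t | ∀ k, c * N k ≤ G k t}
  have hK : IsClosed K := by
    have : K = ⋂ k, {t | c * N k ≤ G k t} := by ext t; simp [K]
    rw [this]
    exact isClosed_iInter fun k => isClosed_le continuous_const (hG k)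
  refine ⟨K, S, ?_, ?_, ?_⟩
  · refine isHelson_of_correlation hK hc hc1 fun v hv hv1 δ hδ => ?_
    obtain ⟨k, hk⟩ := (TopologicalSpace.denseRange_denseSeq UnimodularTest).exists_dist_lt
      ⟨v, hv, hv1⟩ hδ
    refine ⟨d k, (d k).2.2, ?_, N k, ν k, hN k, fun t ht => ht k⟩
    rw [← dist_eq_norm, dist_comm]
    exact hk.le
  · intro h
    have h1 : (distrOfSeq p S).coeff 0 = 0 := by rw [Distr.coeff, h]; rfl
    rw [coeff_distrOfSeq] at h1
    exact hS0 h1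
  · intro t ht
    by_contra hK'
    obtain ⟨k, hk⟩ : ∃ k, G k t < c * N k := by simpa [K] using hK'
    refine ht ⟨{t | G k t < c * N k}, ⟨isOpen_lt (hG k) continuous_const, fun φ hφ => ?_⟩, hk⟩
    -- Every product from index k + 1 on contains `F k`, which vanishes where the k-th correlation
    -- fails, and φ is supported there.
    have hzero : ∀ m, (P (k + 1 + m) * φ : C(Torus, ℂ)) = 0 := by
      intro m
      ext t
      rw [ContinuousMap.mul_apply, ContinuousMap.zero_apply]
      by_cases hFt : F k t = 0
      · have : P (k + 1 + m) t = 0 := by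
          induction m with
          | zero => rw [add_zero, hPF, ContinuousMap.mul_apply, hFt, mul_zero]
          | succ m ih => rw [← add_assoc, hPF, ContinuousMap.mul_apply, ih, zero_mul]
        rw [this, zero_mul]
      · have : (φ : C(Torus, ℂ)) t = 0 := by
          by_contra hne
          exact absurd (hφ (subset_tsupport _ hne)) (not_lt.mpr (hcor k t hFt))
        rw [this, mul_zero]
    have hlim := tendsto_distrOfSeq_apply p
      (hS.comp (Filter.tendsto_add_atTop_nat (k + 1))) φ
    refine tendsto_nhds_unique hlim ?_
    have : ∀ m, (distrOfSeq p (coeffLp p (P (m + (k + 1))))).toFun φ = 0 := by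
      intro m
      rw [distrOfSeq_coeffLp_apply p (hP _), add_comm m, hzero, ← coeffCLM_apply, map_zero]
    simp [this]

end HelsonCircle

theorem theorem3 (q : ℝ) (hq : 2 < q) :
    ∃ (K : Set HelsonCircle.Torus) (S : HelsonCircle.Distr),
      HelsonCircle.IsHelson K ∧ S.toFun ≠ 0 ∧ S.support ⊆ K ∧
        Memℓp S.coeff (ENNReal.ofReal q) := by
  have h2 : (2 : ENNReal) ≤ ENNReal.ofReal q := by
    rw [← ENNReal.ofReal_ofNat]
    exact ENNReal.ofReal_le_ofReal hq.le
  have : Fact (2 ≤ ENNReal.ofReal q) := ⟨h2⟩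
  have : Fact (1 ≤ ENNReal.ofReal q) := ⟨one_le_two.trans h2⟩
  have : Fact (ENNReal.ofReal q ≠ ⊤) := ⟨ENNReal.ofReal_ne_top⟩
  obtain ⟨K, S, hK, hS, hsupp⟩ := HelsonCircle.exists_helson_distr (ENNReal.ofReal q)
    (by rwa [ENNReal.toReal_ofReal (by linarith)])
  refine ⟨K, HelsonCircle.distrOfSeq _ S, hK, hS, hsupp, ?_⟩
  rw [HelsonCircle.coeff_distrOfSeq]
  exact lp.memℓp S
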